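/- Let $\Omega\subset\mathbb{R}^2$ be a bounded convex domain of class $C^3$ whose boundary curvature $k$ (with respect to the inward unit normal $N$) satisfies $k_0\le k\le k_1$ on $\partial\Omega$ for some constants $k_0,k_1>0$; let $T$ be the unit tangent of $\partial\Omega$. Let $\theta:\partial\Omega\to\mathbb{R}$ be differentiable along $\partial\Omega$, and suppose that for some constants $\delta_0,\theta_0>0$ $$|D_T\theta|\le k-\delta_0\quad\text{and}\quad \theta_0\le\theta\le\pi-\theta_0\qquad\text{on }\partial\Omega .$$ Let $F:\mathbb{R}^3\to\mathbb{R}$ be convex, positively homogeneous of degree one and of class $C^2$ on $\mathbb{R}^3\setminus\{0\}$, and suppose that for some positive constants $m_0,M_0,m_1,m_2$ with $m_2<m_0$, writing $\xi(p)=p/|p|$, one has for all $p\in\mathbb{R}^3\setminus\{0\}$ and $1\le i,j\le 2$ $$m_0\le F(\xi)\le M_0,\qquad |D_{p_i}F(\xi(p))|<\frac{m_1}{|p|},\qquad \Big\|\big[D^2_{p_ip_j}F(\xi(p))\big]_{1\le i,j\le 2}\Big\|<\frac{m_2}{|p|^2},$$ where $\|\cdot\|$ is the Frobenius norm and the derivatives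 are those of the function $p\mapsto F(\xi(p))$. Let $G:\mathbb{R}^3\to\mathbb{R}$ be positively homogeneous of degree one, continuous on $\mathbb{R}^3\setminus\{0\}$, with $g_0\le G(\xi)\le G_0$ for $|\xi|=1$ and some constants $g_0,G_0>0$. Let $u_0\in C^3(\overline\Omega)$ satisfy $D_Nu_0=-\sqrt{1+|Du_0|^2}\,\cos\theta$ on $\partial\Omega$. Then there is a constant $C_1>0$, depending on $\Omega,\theta,F,G,u_0$ but not on time, such that for every $\mathcal T>0$ and every solution $u$ of $$\begin{cases}u_t=\displaystyle\sum_{i,j=1}^2 G(Du,-1)\,D^2_{p_ip_j}F(Du,-1)\,u_{x_ix_j}&\text{in }Q_{\mathcal T}=\Omega\times[0,\mathcal T],\\[1ex] D_Nu=-\sqrt{1+|Du|^2}\,\cos\theta&\text{on }\partial\Omega\times[0,\mathcal T],\\ u(\cdot,0)=u_0&\text{in }\Omega,\end{cases}$$ of class $C^{2,1}$ on $\overline\Omega\times[0,\mathcal T]$ (that is, $u,Du,D^2u,u_t$ exist and are continuous there), $$\sup_{Q_{\mathcal T}}|Du|\le C_1 .$$ -/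

import Mathlib

namespace AnisoMCF

/-- The plane with its Euclidean norm. -/
abbrev E2 := EuclideanSpace ℝ (Fin 2)

/-- Three-dimensional Euclidean space, where the anisotropy and the mobility live. -/
abbrev E3 := EuclideanSpace ℝ (Fin 3)

/-! ### The domain and the geometry of its boundary -/

/-- `Ω` is a bounded convex domain of the plane of class `C³`, with `C³` defining function `ρ`:
`Ω = {ρ < 0}` and `∇ρ ≠ 0` on `{ρ = 0}` (hence `∂Ω = {ρ = 0}`). -/
structure IsC3ConvexDomain (Ω : Set E2) (ρ : E2 → ℝ) : Prop where
  nonempty : Ω.Nonempty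
  bounded : Bornology.IsBounded Ω
  convex : Convex ℝ Ω
  contDiff : ContDiff ℝ 3 ρ
  eq_sublevel : Ω = {x | ρ x < 0}
  gradient_ne_zero : ∀ x, ρ x = 0 → gradient ρ x ≠ 0

/-- The inward unit normal `N = -∇ρ / |∇ρ|` of the boundary of `{ρ < 0}`. -/
noncomputable def innerNormal (ρ : E2 → ℝ) (x : E2) : E2 :=
  -(‖gradient ρ x‖⁻¹ • gradient ρ x)

/-- The (counterclockwise) unit tangent `T` of the boundary: `N` is `T` turned by `π / 2`. -/
noncomputable def unitTangent (ρ : E2 → ℝ) (x : E2) : E2 :=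
  !₂[innerNormal ρ x 1, -innerNormal ρ x 0]

/-- The curvature `k` of the boundary of `{ρ < 0}`, with `D_T T = k N`: the curvature
`div (∇ρ / |∇ρ|) = D²ρ(T, T) / |∇ρ|` of the level curve of `ρ`. A disc of radius `r` has
`k = 1 / r`. -/
noncomputable def curvature (ρ : E2 → ℝ) (x : E2) : ℝ :=
  fderiv ℝ (fderiv ℝ ρ) x (unitTangent ρ x) (unitTangent ρ x) / ‖gradient ρ x‖

/-- The derivative `D_T θ` along the boundary of `Ω = {ρ < 0}` of a function `θ` that matters on
`∂Ω` only. The derivative is taken within the curve `∂Ω`; its value on the tangent vector `T` is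
uniquely determined and is the derivative of `θ` with respect to arclength. -/
noncomputable def tangentialDeriv (Ω : Set E2) (ρ θ : E2 → ℝ) (x : E2) : ℝ :=
  fderivWithin ℝ θ (frontier Ω) x (unitTangent ρ x)

/-- The contact angle: `θ` is differentiable along `∂Ω`, `|D_T θ| ≤ k - δ₀` and
`θ₀ ≤ θ ≤ π - θ₀` on `∂Ω`. -/
structure IsContactAngle (Ω : Set E2) (ρ θ : E2 → ℝ) (δ₀ θ₀ : ℝ) : Prop where
  differentiableOn : DifferentiableOn ℝ θ (frontier Ω)
  abs_deriv_le : ∀ x ∈ frontier Ω, |tangentialDeriv Ω ρ θ x| ≤ curvature ρ x - δ₀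
  le_angle : ∀ x ∈ frontier Ω, θ₀ ≤ θ x
  angle_le : ∀ x ∈ frontier Ω, θ x ≤ Real.pi - θ₀

/-! ### Anisotropy and mobility -/

/-- The partial derivative `∂f/∂p_i`. -/
noncomputable def partialD (i : Fin 3) (f : E3 → ℝ) (p : E3) : ℝ :=
  fderiv ℝ f p (EuclideanSpace.single i 1)

/-- The function `p ↦ F (ξ(p))`, `ξ(p) = p / |p|`. -/
noncomputable def onSphere (F : E3 → ℝ) (p : E3) : ℝ := F (‖p‖⁻¹ • p)

/-- The index of a horizontal coordinate of `E3` (the first two coordinates). -/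
abbrev hor (i : Fin 2) : Fin 3 := Fin.castSucc i

/-- An anisotropy: a function on `E3`, homogeneous of degree one, convex, of class `C²` off the
origin, with constants `m₀, M₀, m₁, m₂` such that, with `ξ = p / |p|` and `i, j` ranging over the
horizontal indices, `m₀ ≤ F(ξ) ≤ M₀`, `|D_{p_i} F(ξ)| < m₁ / |p|`, and the matrix
`[D²_{p_i p_j} F(ξ)]` has Frobenius norm `< m₂ / |p|²`. -/
structure IsAnisotropy (F : E3 → ℝ) (m₀ M₀ m₁ m₂ : ℝ) : Prop where
  homogeneous : ∀ (c : ℝ) (p : E3), 0 < c → F (c • p) = c * F p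
  convexOn : ConvexOn ℝ Set.univ F
  contDiffOn : ContDiffOn ℝ 2 F {0}ᶜ
  lower : ∀ ξ : E3, ‖ξ‖ = 1 → m₀ ≤ F ξ
  upper : ∀ ξ : E3, ‖ξ‖ = 1 → F ξ ≤ M₀
  first_deriv : ∀ p : E3, p ≠ 0 → ∀ i : Fin 2,
    |partialD (hor i) (onSphere F) p| < m₁ / ‖p‖
  second_deriv : ∀ p : E3, p ≠ 0 →
    Real.sqrt (∑ i : Fin 2, ∑ j : Fin 2,
      (partialD (hor i) (partialD (hor j) (onSphere F)) p) ^ 2) < m₂ / ‖p‖ ^ 2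

/-- A mobility: a function on `E3`, homogeneous of degree one, continuous off the origin, with
`g₀ ≤ G ≤ G₀` on the unit sphere. -/
structure IsMobility (G : E3 → ℝ) (g₀ G₀ : ℝ) : Prop where
  homogeneous : ∀ (c : ℝ) (p : E3), 0 ≤ c → G (c • p) = c * G p
  continuousOn : ContinuousOn G {0}ᶜ
  lower : ∀ ξ : E3, ‖ξ‖ = 1 → g₀ ≤ G ξ
  upper : ∀ ξ : E3, ‖ξ‖ = 1 → G ξ ≤ G₀

/-- The vector `(q, -1)` of `E3`, for `q` in the plane. -/
noncomputable def lift (q : E2) : E3 := !₂[q 0, q 1, -1]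

/-- The coefficients `a^{ij}(q) = G(q, -1) D²_{p_i p_j} F(q, -1)`. -/
noncomputable def coeff (F G : E3 → ℝ) (q : E2) (i j : Fin 2) : ℝ :=
  G (lift q) * partialD (hor i) (partialD (hor j) F) (lift q)

/-! ### The flow -/

/-- The gradient of `w` on the closure of `Ω` (one-sided at boundary points). -/
noncomputable def grad (Ω : Set E2) (w : E2 → ℝ) (x : E2) : E2 :=
  gradientWithin w (closure Ω) x

/-- The Hessian of `w` on the closure of `Ω` (one-sided at boundary points), as the derivative of
the gradient. -/
noncomputable def hess (Ω : Set E2) (w : E2 → ℝ) (x : E2) : E2 →L[ℝ] E2 :=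
  fderivWithin ℝ (grad Ω w) (closure Ω) x

/-- The second partial derivative `w_{x_i x_j}`. -/
noncomputable def hessEntry (Ω : Set E2) (w : E2 → ℝ) (x : E2) (i j : Fin 2) : ℝ :=
  hess Ω w x (EuclideanSpace.single j 1) i

/-- The time derivative of `u` on `[0, τ]` (one-sided at the end points). -/
noncomputable def timeDeriv (τ : ℝ) (u : E2 → ℝ → ℝ) (x : E2) (t : ℝ) : ℝ :=
  derivWithin (u x) (Set.Icc 0 τ) t

/-- `u` is of class `C^{2,1}` on `closure Ω × [0, τ]`: `u`, `Du`, `D²u`, `u_t` exist and are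
continuous there. -/
structure IsC21 (Ω : Set E2) (τ : ℝ) (u : E2 → ℝ → ℝ) : Prop where
  differentiableOn : ∀ t ∈ Set.Icc 0 τ, DifferentiableOn ℝ (fun x => u x t) (closure Ω)
  differentiableOn_grad : ∀ t ∈ Set.Icc 0 τ,
    DifferentiableOn ℝ (grad Ω (fun x => u x t)) (closure Ω)
  differentiableOn_time : ∀ x ∈ closure Ω, DifferentiableOn ℝ (u x) (Set.Icc 0 τ)
  continuousOn : ContinuousOn (fun z : E2 × ℝ => u z.1 z.2) (closure Ω ×ˢ Set.Icc 0 τ)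
  continuousOn_grad :
    ContinuousOn (fun z : E2 × ℝ => grad Ω (fun x => u x z.2) z.1) (closure Ω ×ˢ Set.Icc 0 τ)
  continuousOn_hess :
    ContinuousOn (fun z : E2 × ℝ => hess Ω (fun x => u x z.2) z.1) (closure Ω ×ˢ Set.Icc 0 τ)
  continuousOn_time :
    ContinuousOn (fun z : E2 × ℝ => timeDeriv τ u z.1 z.2) (closure Ω ×ˢ Set.Icc 0 τ)

/-- The contact angle boundary condition `D_N w = -√(1 + |Dw|²) cos θ` on `∂Ω`. -/
def ContactCondition (Ω : Set E2) (ρ θ w : E2 → ℝ) : Prop :=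
  ∀ x ∈ frontier Ω, inner ℝ (innerNormal ρ x) (grad Ω w x) =
    -(Real.sqrt (1 + ‖grad Ω w x‖ ^ 2) * Real.cos (θ x))

/-- Initial data: `C³` up to the boundary and compatible with the contact angle. -/
structure IsInitialDatum (Ω : Set E2) (ρ θ u₀ : E2 → ℝ) : Prop where
  contDiffOn : ContDiffOn ℝ 3 u₀ (closure Ω)
  compatible : ContactCondition Ω ρ θ u₀

/-- `u` solves the anisotropic mean curvature flow with mobility and contact angle boundary
condition on `Ω × [0, τ]`, with initial datum `u₀`. -/
structure IsSolution (Ω : Set E2) (ρ θ : E2 → ℝ) (F G : E3 → ℝ) (u₀ : E2 → ℝ) (τ : ℝ)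
    (u : E2 → ℝ → ℝ) : Prop where
  regular : IsC21 Ω τ u
  equation : ∀ x ∈ Ω, ∀ t ∈ Set.Icc 0 τ, timeDeriv τ u x t =
    ∑ i : Fin 2, ∑ j : Fin 2,
      coeff F G (grad Ω (fun y => u y t) x) i j * hessEntry Ω (fun y => u y t) x i j
  boundary : ∀ t ∈ Set.Icc 0 τ, ContactCondition Ω ρ θ (fun y => u y t)
  initial : ∀ x ∈ Ω, u x 0 = u₀ x

end AnisoMCF

/-!
The bound is a maximum principle argument that uses only two space derivatives and one time
derivative of the solution, all continuous up to the boundary; since `G` is merely continuous, the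
equation is never differentiated.

*Maxima at the boundary behave like interior ones.* If `f` and `g` both have the contact angle `θ`
and `f - g` has a maximum at a boundary point, then the tangential derivatives agree there, and the
contact condition recovers the normal derivative from them, so the gradients agree
(`grad_eq_of_max`). Hence the second order condition holds along inward directions, thus along all
directions by continuity and evenness (`hess_le_of_max`). The equation itself extends to the
boundary by continuity. This gives a comparison principle (`IsContactEvolution.comparison`), and
comparison with `u₀ ± C t` and with time shifts of `u` bounds `|u_t|` by the maximum `C` of
`|a^{ij}(Du₀) (u₀)_{ij}|` (`IsSolution.abs_timeDeriv_le`).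

*The gradient is largest on the parabolic boundary.* The equation is invariant under translations,
so the difference `u(· + k, t) - u(·, t)` has no interior maximum at a positive time; dividing by
`|k|` and using the uniform continuity of `Du` near the boundary gives `IsSolution.norm_grad_le`.

*Boundary maxima of `|Du|`.* Let `v = √(1 + |Du|²)`, and suppose `|Du(·, t)|` is maximal at
`x ∈ ∂Ω`. In the frame `(T, N)`, the first order conditions are
`u_T u_{TT} + u_N u_{TN} = 0` and `u_T u_{TN} + u_N u_{NN} ≤ 0`, and differentiating the contact
condition along `∂Ω` gives `u_{TN} = k u_T + v sin θ D_T θ`. With `u_T² = v² sin² θ - 1` and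
`|D_T θ| ≤ k - δ₀` the quantity `A = u_T u_{TN}` is at least `δ₀ u_T² - k / 2`, of order `v²`. On
the other hand `u_T² u_N D²u + A w ⊗ w ≤ 0` for `w = u_N T - u_T N`, which is orthogonal to `Du`.
In that direction `a^{ij} w_i w_j ≥ g₀ (m₀ - m₂) |w|²`, uniformly in `Du`
(`le_sum_coeff_of_inner_eq_zero`). So `g₀ (m₀ - m₂) A ≤ |u_N| |u_t| ≤ C v`, and `v² = O(v)`
(`boundary_gradient_estimate`).
-/

open Set Filter Topology

namespace AnisoMCF

/-! ### One-sided first and second order conditions on the line -/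

lemma deriv_nonpos_of_eventually_le {φ : ℝ → ℝ} {c : ℝ} (h : HasDerivWithinAt φ c (Ioi 0) 0)
    (hle : ∀ᶠ s in 𝓝[>] (0 : ℝ), φ s ≤ φ 0) : c ≤ 0 := by
  rw [hasDerivWithinAt_iff_tendsto_slope' (by simp)] at h
  refine le_of_tendsto h ?_
  filter_upwards [hle, self_mem_nhdsWithin] with s hs hs0
  rw [slope_def_field]
  exact div_nonpos_of_nonpos_of_nonneg (by linarith) (by simpa using (le_of_lt hs0))

lemma eventually_pos_of_deriv_pos {φ : ℝ → ℝ} {c : ℝ} (h : HasDerivWithinAt φ c (Ioi 0) 0)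
    (hc : 0 < c) : ∀ᶠ s in 𝓝[>] (0 : ℝ), φ 0 < φ s := by
  rw [hasDerivWithinAt_iff_tendsto_slope' (by simp)] at h
  filter_upwards [h.eventually (lt_mem_nhds hc), self_mem_nhdsWithin] with s hs hs0
  rw [slope_def_field] at hs
  have h0 : 0 < s - 0 := by simpa using hs0
  have := (div_pos_iff_of_pos_right h0).1 hs
  linarith

/-- If `φ` has a one-sided maximum and a vanishing one-sided derivative at `0`, then its one-sided
second derivative there is nonpositive. -/
lemma second_deriv_nonpos_of_eventually_le {φ φ' : ℝ → ℝ} {c : ℝ}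
    (hd : ∀ᶠ s in 𝓝[>] (0 : ℝ), HasDerivAt φ (φ' s) s)
    (hcont : ContinuousWithinAt φ (Ioi 0) 0) (h0 : φ' 0 = 0)
    (hd2 : HasDerivWithinAt φ' c (Ioi 0) 0)
    (hle : ∀ᶠ s in 𝓝[>] (0 : ℝ), φ s ≤ φ 0) : c ≤ 0 := by
  by_contra! hc
  have hpos := eventually_pos_of_deriv_pos hd2 hc
  obtain ⟨ε, hε, hall⟩ := mem_nhdsGT_iff_exists_Ioo_subset.1 (hd.and (hpos.and hle))
  have hε0 : (0 : ℝ) < ε := hε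
  have hmem : ∀ s, 0 < s → s < ε → HasDerivAt φ (φ' s) s ∧ φ' 0 < φ' s ∧ φ s ≤ φ 0 :=
    fun s h1 h2 => hall ⟨h1, h2⟩
  have hmono : StrictMonoOn φ (Icc 0 (ε / 2)) := by
    refine strictMonoOn_of_deriv_pos (convex_Icc _ _) ?_ ?_
    · intro s hs
      rcases hs.1.eq_or_lt with h | h
      · rw [← h]
        exact (continuousWithinAt_Ioi_iff_Ici.1 hcont).mono Icc_subset_Ici_self
      · exact (hmem s h (by linarith [hs.2])).1.continuousAt.continuousWithinAt
    · intro s hs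
      rw [interior_Icc] at hs
      obtain ⟨h1, h2, -⟩ := hmem s hs.1 (by linarith [hs.2])
      rw [h1.deriv]; linarith
  have h1 := hmono (a := 0) (b := ε / 2) ⟨le_rfl, by linarith⟩ ⟨by linarith, le_rfl⟩ (by linarith)
  have h2 := (hmem (ε / 2) (by linarith) (by linarith)).2.2
  linarith

/-! ### The domain and its inward directions -/

lemma IsC3ConvexDomain.isOpen {Ω : Set E2} {ρ : E2 → ℝ} (h : IsC3ConvexDomain Ω ρ) :
    IsOpen Ω := by
  rw [h.eq_sublevel]
  exact isOpen_lt h.contDiff.continuous continuous_const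

lemma IsC3ConvexDomain.isCompact_closure {Ω : Set E2} {ρ : E2 → ℝ} (h : IsC3ConvexDomain Ω ρ) :
    IsCompact (closure Ω) :=
  h.bounded.isCompact_closure

lemma IsC3ConvexDomain.interior_closure_nonempty {Ω : Set E2} {ρ : E2 → ℝ}
    (h : IsC3ConvexDomain Ω ρ) : (interior (closure Ω)).Nonempty :=
  h.nonempty.mono (interior_maximal subset_closure h.isOpen)

lemma IsC3ConvexDomain.uniqueDiffOn {Ω : Set E2} {ρ : E2 → ℝ} (h : IsC3ConvexDomain Ω ρ) :
    UniqueDiffOn ℝ (closure Ω) :=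
  uniqueDiffOn_convex h.convex.closure h.interior_closure_nonempty

lemma IsC3ConvexDomain.eq_zero_of_mem_frontier {Ω : Set E2} {ρ : E2 → ℝ}
    (h : IsC3ConvexDomain Ω ρ) {x : E2} (hx : x ∈ frontier Ω) : ρ x = 0 := by
  rw [h.isOpen.frontier_eq] at hx
  refine le_antisymm ?_ ?_
  · have : closure Ω ⊆ {x | ρ x ≤ 0} := by
      refine closure_minimal ?_ (isClosed_le h.contDiff.continuous continuous_const)
      rw [h.eq_sublevel]
      exact fun y hy => (show ρ y < 0 from hy).le
    exact this hx.1
  · by_contra! hneg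
    apply hx.2
    rw [h.eq_sublevel]
    exact hneg

/-- `ξ` points into `Ω` from `x`: the points `x + s ξ` lie in `Ω` for all small `s > 0`. -/
def PointsInto (Ω : Set E2) (x ξ : E2) : Prop :=
  ∀ᶠ s in 𝓝[>] (0 : ℝ), x + s • ξ ∈ Ω

lemma pointsInto_of_mem {Ω : Set E2} (hΩ : IsOpen Ω) {x : E2} (hx : x ∈ Ω) (ξ : E2) :
    PointsInto Ω x ξ := by
  have hc : ContinuousAt (fun s : ℝ => x + s • ξ) 0 := by fun_prop
  have : ∀ᶠ s in 𝓝 (0 : ℝ), x + s • ξ ∈ Ω :=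
    hc.eventually_mem (by simpa using hΩ.mem_nhds hx)
  exact this.filter_mono nhdsWithin_le_nhds

lemma IsC3ConvexDomain.differentiable {Ω : Set E2} {ρ : E2 → ℝ} (h : IsC3ConvexDomain Ω ρ) :
    Differentiable ℝ ρ :=
  h.contDiff.differentiable (by norm_num)

lemma IsC3ConvexDomain.pointsInto_of_fderiv_neg {Ω : Set E2} {ρ : E2 → ℝ}
    (h : IsC3ConvexDomain Ω ρ) {x ξ : E2} (hx : ρ x = 0) (hξ : fderiv ℝ ρ x ξ < 0) :
    PointsInto Ω x ξ := by
  have hline : HasDerivAt (fun s : ℝ => x + s • ξ) ξ 0 := by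
    simpa using ((hasDerivAt_id (0 : ℝ)).smul_const ξ).const_add x
  have hρ : HasFDerivAt ρ (fderiv ℝ ρ x) (x + (0 : ℝ) • ξ) := by
    simpa using (h.differentiable x).hasFDerivAt
  have hd : HasDerivAt (fun s : ℝ => -ρ (x + s • ξ)) (-(fderiv ℝ ρ x ξ)) 0 :=
    (hρ.comp_hasDerivAt 0 hline).neg
  filter_upwards [eventually_pos_of_deriv_pos hd.hasDerivWithinAt (by linarith)] with s hs
  rw [h.eq_sublevel]
  simp [hx] at hs
  exact hs

lemma inner_innerNormal {ρ : E2 → ℝ} (x ξ : E2) :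
    inner ℝ (innerNormal ρ x) ξ = -(‖gradient ρ x‖⁻¹ * fderiv ℝ ρ x ξ) := by
  rw [innerNormal, inner_neg_left, real_inner_smul_left, inner_gradient_left]

lemma IsC3ConvexDomain.pointsInto_of_inner_pos {Ω : Set E2} {ρ : E2 → ℝ}
    (h : IsC3ConvexDomain Ω ρ) {x ξ : E2} (hx : x ∈ frontier Ω)
    (hξ : 0 < inner ℝ (innerNormal ρ x) ξ) : PointsInto Ω x ξ := by
  have hx0 := h.eq_zero_of_mem_frontier hx
  refine h.pointsInto_of_fderiv_neg hx0 ?_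
  have hg : 0 < ‖gradient ρ x‖⁻¹ := inv_pos.2 (norm_pos_iff.2 (h.gradient_ne_zero x hx0))
  rw [inner_innerNormal] at hξ
  by_contra! hcon
  have := mul_nonneg hg.le hcon
  linarith

lemma norm_innerNormal {ρ : E2 → ℝ} {x : E2} (hx : gradient ρ x ≠ 0) :
    ‖innerNormal ρ x‖ = 1 := by
  rw [innerNormal, norm_neg, norm_smul, norm_inv, norm_norm, inv_mul_cancel₀ (norm_ne_zero_iff.2 hx)]

/-- The zero set of the defining function is contained in the boundary. -/
lemma IsC3ConvexDomain.mem_frontier_of_eq_zero {Ω : Set E2} {ρ : E2 → ℝ}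
    (h : IsC3ConvexDomain Ω ρ) {x : E2} (hx : ρ x = 0) : x ∈ frontier Ω := by
  rw [h.isOpen.frontier_eq]
  refine ⟨?_, ?_⟩
  · have hneg : fderiv ℝ ρ x (-gradient ρ x) < 0 := by
      rw [map_neg, ← inner_gradient_left, real_inner_self_eq_norm_sq]
      have := norm_pos_iff.2 (h.gradient_ne_zero x hx)
      simp; positivity
    have hp := h.pointsInto_of_fderiv_neg hx hneg
    have hc : Tendsto (fun s : ℝ => x + s • (-gradient ρ x)) (𝓝[>] 0) (𝓝 x) := by
      have : ContinuousAt (fun s : ℝ => x + s • (-gradient ρ x)) 0 := by fun_prop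
      simpa [ContinuousAt] using this.tendsto.mono_left nhdsWithin_le_nhds
    exact mem_closure_of_tendsto hc hp
  · rw [h.eq_sublevel]
    simp [hx]

/-- The tangent vectors of the boundary, i.e. the kernel of `Dρ`, lie in its tangent cone: by the
implicit function theorem they are velocities of curves in `{ρ = 0}`. -/
lemma IsC3ConvexDomain.mem_tangentConeAt_frontier {Ω : Set E2} {ρ : E2 → ℝ}
    (h : IsC3ConvexDomain Ω ρ) {x ξ : E2} (hx : ρ x = 0) (hξ : fderiv ℝ ρ x ξ = 0) :
    ξ ∈ tangentConeAt ℝ (frontier Ω) x := by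
  have hs : HasStrictFDerivAt ρ (fderiv ℝ ρ x) x :=
    (h.contDiff.contDiffAt).hasStrictFDerivAt (by norm_num)
  have hr : ((fderiv ℝ ρ x) : E2 →ₗ[ℝ] ℝ).range = ⊤ := by
    refine LinearMap.range_eq_top.2 (LinearMap.surjective ?_)
    intro h0
    apply h.gradient_ne_zero x hx
    have h1 : fderiv ℝ ρ x = 0 := by
      ext v; exact congrArg (fun l : E2 →ₗ[ℝ] ℝ => l v) h0
    rw [gradient, h1, map_zero]
  set γ := hs.implicitFunction ρ (fderiv ℝ ρ x) hr (ρ x) with hγ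
  let ξk : ((fderiv ℝ ρ x) : E2 →ₗ[ℝ] ℝ).ker := ⟨ξ, hξ⟩
  have hγ0 : γ 0 = x := by
    have := hs.implicitFunction_apply_image hr
    exact this
  have hγd : HasFDerivAt γ (((fderiv ℝ ρ x) : E2 →ₗ[ℝ] ℝ).ker.subtypeL) 0 :=
    (hs.to_implicitFunction hr).hasFDerivAt
  have hline : HasDerivAt (fun s : ℝ => s • ξk) ξk 0 := by
    simpa using (hasDerivAt_id (0 : ℝ)).smul_const ξk
  have hd : HasDerivAt (fun s : ℝ => γ (s • ξk)) ξ 0 := by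
    have h0 : HasFDerivAt γ (((fderiv ℝ ρ x) : E2 →ₗ[ℝ] ℝ).ker.subtypeL) ((0 : ℝ) • ξk) := by
      simpa using hγd
    exact h0.comp_hasDerivAt 0 hline
  have hin : ∀ᶠ s in 𝓝 (0 : ℝ), γ (s • ξk) ∈ frontier Ω := by
    have hm := hs.map_implicitFunction_eq hr
    have hc : Tendsto (fun s : ℝ => (ρ x, s • ξk)) (𝓝 0) (𝓝 (ρ x, 0)) := by
      have : ContinuousAt (fun s : ℝ => (ρ x, s • ξk)) 0 := by fun_prop
      simpa [ContinuousAt] using this.tendsto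
    filter_upwards [hc.eventually hm] with s hs'
    exact h.mem_frontier_of_eq_zero (hs'.trans hx)
  refine mem_tangentConeAt_of_seq (𝓝[≠] (0 : ℝ)) (fun s => s⁻¹) (fun s => γ (s • ξk) - x) ?_ ?_ ?_
  · have := hd.continuousAt.tendsto
    simp only [zero_smul, hγ0] at this
    simpa using (this.sub_const x).mono_left nhdsWithin_le_nhds
  · filter_upwards [hin.filter_mono nhdsWithin_le_nhds] with s hs'
    simpa using hs'
  · have := hasDerivAt_iff_tendsto_slope_zero.1 hd
    simpa [hγ0] using this

/-! ### Derivatives along inward segments -/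

lemma PointsInto.hasDerivWithinAt {V : Type*} [NormedAddCommGroup V] [NormedSpace ℝ V]
    {Ω : Set E2} {x ξ : E2} (hξ : PointsInto Ω x ξ) {g : E2 → V} {g' : E2 →L[ℝ] V}
    (hg : HasFDerivWithinAt g g' (closure Ω) x) :
    HasDerivWithinAt (fun s : ℝ => g (x + s • ξ)) (g' ξ) (Ioi 0) 0 := by
  obtain ⟨ε, hε, hall⟩ := mem_nhdsGT_iff_exists_Ioo_subset.1 hξ
  have hline : HasDerivAt (fun s : ℝ => x + s • ξ) ξ 0 := by
    simpa using ((hasDerivAt_id (0 : ℝ)).smul_const ξ).const_add x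
  have hg0 : HasFDerivWithinAt g g' (closure Ω) (x + (0 : ℝ) • ξ) := by simpa using hg
  rw [← HasDerivWithinAt.Ioi_iff_Ioo (show (0 : ℝ) < ε from hε)]
  exact hg0.comp_hasDerivWithinAt 0 hline.hasDerivWithinAt
    (fun s hs => subset_closure (hall hs))

lemma hasFDerivWithinAt_of_grad {Ω : Set E2} {f : E2 → ℝ} {x : E2}
    (hf : DifferentiableWithinAt ℝ f (closure Ω) x) :
    HasFDerivWithinAt f (InnerProductSpace.toDual ℝ E2 (grad Ω f x)) (closure Ω) x :=
  hf.hasGradientWithinAt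

lemma hasDerivAt_line_of_mem {Ω : Set E2} (hΩ : IsOpen Ω) {f : E2 → ℝ}
    (hf : DifferentiableOn ℝ f (closure Ω)) {x ξ : E2} {s : ℝ} (hs : x + s • ξ ∈ Ω) :
    HasDerivAt (fun s : ℝ => f (x + s • ξ)) (inner ℝ (grad Ω f (x + s • ξ)) ξ) s := by
  have hline : HasDerivAt (fun s : ℝ => x + s • ξ) ξ s := by
    simpa using ((hasDerivAt_id s).smul_const ξ).const_add x
  have hf' := (hasFDerivWithinAt_of_grad (hf _ (subset_closure hs))).hasFDerivAt
    (mem_of_superset (hΩ.mem_nhds hs) subset_closure)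
  exact hf'.comp_hasDerivAt s hline

/-- First order condition, for a maximum of `f (x + ·) - g (y + ·)` in the direction `ξ`. -/
lemma inner_grad_le_of_eventually_le {Ω : Set E2} {f g : E2 → ℝ} {x y ξ : E2}
    (hx : x ∈ closure Ω) (hy : y ∈ closure Ω)
    (hf : DifferentiableOn ℝ f (closure Ω)) (hg : DifferentiableOn ℝ g (closure Ω))
    (hxξ : PointsInto Ω x ξ) (hyξ : PointsInto Ω y ξ)
    (hle : ∀ᶠ s in 𝓝[>] (0 : ℝ), f (x + s • ξ) - g (y + s • ξ) ≤ f x - g y) :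
    inner ℝ (grad Ω f x) ξ ≤ inner ℝ (grad Ω g y) ξ := by
  have h1 := hxξ.hasDerivWithinAt (hasFDerivWithinAt_of_grad (hf x hx))
  have h2 := hyξ.hasDerivWithinAt (hasFDerivWithinAt_of_grad (hg y hy))
  have h3 := deriv_nonpos_of_eventually_le (h1.sub h2) (by simpa using hle)
  simp only [InnerProductSpace.toDual_apply_apply] at h3
  linarith

/-- Second order condition, for a maximum of `f (x + ·) - g (y + ·)` in the direction `ξ`. -/
lemma inner_hess_le_of_eventually_le {Ω : Set E2} (hΩ : IsOpen Ω) {f g : E2 → ℝ} {x y ξ : E2}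
    (hx : x ∈ closure Ω) (hy : y ∈ closure Ω)
    (hf : DifferentiableOn ℝ f (closure Ω)) (hg : DifferentiableOn ℝ g (closure Ω))
    (hf2 : DifferentiableOn ℝ (grad Ω f) (closure Ω))
    (hg2 : DifferentiableOn ℝ (grad Ω g) (closure Ω))
    (hxξ : PointsInto Ω x ξ) (hyξ : PointsInto Ω y ξ)
    (heq : grad Ω f x = grad Ω g y)
    (hle : ∀ᶠ s in 𝓝[>] (0 : ℝ), f (x + s • ξ) - g (y + s • ξ) ≤ f x - g y) :
    inner ℝ (hess Ω f x ξ) ξ ≤ inner ℝ (hess Ω g y ξ) ξ := by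
  have h1 := hxξ.hasDerivWithinAt (hasFDerivWithinAt_of_grad (hf x hx))
  have h2 := hyξ.hasDerivWithinAt (hasFDerivWithinAt_of_grad (hg y hy))
  have h3 := hxξ.hasDerivWithinAt (hf2 x hx).hasFDerivWithinAt
  have h4 := hyξ.hasDerivWithinAt (hg2 y hy).hasFDerivWithinAt
  have h5 := (h3.sub h4).inner ℝ (hasDerivWithinAt_const (0 : ℝ) (Ioi 0) ξ)
  have h6 := second_deriv_nonpos_of_eventually_le
    (φ := fun s : ℝ => f (x + s • ξ) - g (y + s • ξ))
    (φ' := fun s : ℝ => inner ℝ (grad Ω f (x + s • ξ) - grad Ω g (y + s • ξ)) ξ) ?_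
    (h1.sub h2).continuousWithinAt (by simp [heq]) h5 (by simpa using hle)
  · simp only [inner_zero_right, zero_add, Pi.sub_apply, zero_smul, add_zero, inner_sub_left] at h6
    unfold hess
    linarith
  · filter_upwards [hxξ, hyξ] with s hs1 hs2
    rw [inner_sub_left]
    exact (hasDerivAt_line_of_mem hΩ hf hs1).sub (hasDerivAt_line_of_mem hΩ hg hs2)

/-! ### Ellipticity of the coefficients -/

/-- The horizontal vector `(w, 0)` of `E3`. -/
noncomputable def horizontal (w : E2) : E3 := ∑ i : Fin 2, w i • EuclideanSpace.single (hor i) 1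

lemma lift_add_smul (q w : E2) (s : ℝ) : lift q + s • horizontal w = lift (q + s • w) := by
  ext i
  fin_cases i <;> simp [lift, horizontal, hor, Fin.sum_univ_two, Fin.ext_iff]

lemma lift_ne_zero (q : E2) : lift q ≠ 0 := by
  intro h
  have := congrArg (fun p : E3 => p 2) h
  simp [lift] at this

lemma norm_lift (q : E2) : ‖lift q‖ = Real.sqrt (1 + ‖q‖ ^ 2) := by
  rw [EuclideanSpace.norm_eq, EuclideanSpace.norm_eq q, Real.sq_sqrt (by positivity)]
  congr 1
  simp [lift, Fin.sum_univ_three, Fin.sum_univ_two]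
  ring

lemma continuous_lift : Continuous lift := by
  unfold lift
  fun_prop

lemma partialD_partialD {f : E3 → ℝ} {p : E3} (hf : ContDiffAt ℝ 2 f p) (i j : Fin 3) :
    partialD i (partialD j f) p =
      fderiv ℝ (fderiv ℝ f) p (EuclideanSpace.single i 1) (EuclideanSpace.single j 1) := by
  have h1 : DifferentiableAt ℝ (fderiv ℝ f) p :=
    (hf.fderiv_right (m := 1) (by norm_num)).differentiableAt (by norm_num)
  have h2 := h1.hasFDerivAt.clm_apply
    (hasFDerivAt_const (EuclideanSpace.single j (1 : ℝ) : E3) p)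
  have h3 : partialD j f = fun p => fderiv ℝ f p (EuclideanSpace.single j 1) := rfl
  rw [partialD, h3, h2.fderiv]
  simp

lemma sum_partialD_partialD {f : E3 → ℝ} {p : E3} (hf : ContDiffAt ℝ 2 f p) (w : E2) :
    ∑ i : Fin 2, ∑ j : Fin 2, partialD (hor i) (partialD (hor j) f) p * w i * w j =
      fderiv ℝ (fderiv ℝ f) p (horizontal w) (horizontal w) := by
  simp only [partialD_partialD hf, horizontal, Fin.sum_univ_two, map_add, map_smul,
    add_apply, smul_apply, smul_eq_mul]
  ring

lemma partialD_partialD_comm {f : E3 → ℝ} {p : E3} (hf : ContDiffAt ℝ 2 f p) (i j : Fin 3) :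
    partialD i (partialD j f) p = partialD j (partialD i f) p := by
  rw [partialD_partialD hf, partialD_partialD hf]
  exact hf.isSymmSndFDerivAt (by simp) _ _

lemma hasDerivAt_lift_line {V : Type*} [NormedAddCommGroup V] [NormedSpace ℝ V] {f : E3 → V}
    (q w : E2) (s : ℝ) (hf : DifferentiableAt ℝ f (lift (q + s • w))) :
    HasDerivAt (fun s : ℝ => f (lift (q + s • w)))
      (fderiv ℝ f (lift (q + s • w)) (horizontal w)) s := by
  have hline : HasDerivAt (fun s : ℝ => lift q + s • horizontal w) (horizontal w) s := by
    simpa using ((hasDerivAt_id s).smul_const (horizontal w)).const_add (lift q)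
  simp only [lift_add_smul] at hline
  exact hf.hasFDerivAt.comp_hasDerivAt s hline

lemma hasDerivAt_fderiv_lift_line {f : E3 → ℝ} (q w : E2) (hf : ContDiffAt ℝ 2 f (lift q)) :
    HasDerivAt (fun s : ℝ => fderiv ℝ f (lift (q + s • w)) (horizontal w))
      (fderiv ℝ (fderiv ℝ f) (lift q) (horizontal w) (horizontal w)) 0 := by
  have e : q + (0 : ℝ) • w = q := by simp
  have h1 : DifferentiableAt ℝ (fderiv ℝ f) (lift (q + (0 : ℝ) • w)) := by
    rw [e]
    exact (hf.fderiv_right (m := 1) (by norm_num)).differentiableAt (by norm_num)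
  have h2 := hasDerivAt_lift_line q w 0 h1
  rw [e] at h2
  exact (ContinuousLinearMap.apply ℝ ℝ (horizontal w)).hasFDerivAt.comp_hasDerivAt 0 h2

section Anisotropy

variable {F G : E3 → ℝ} {m₀ M₀ m₁ m₂ g₀ G₀ : ℝ}

lemma IsAnisotropy.contDiffAt (hF : IsAnisotropy F m₀ M₀ m₁ m₂) {p : E3} (hp : p ≠ 0) :
    ContDiffAt ℝ 2 F p :=
  hF.contDiffOn.contDiffAt (isOpen_compl_singleton.mem_nhds hp)

lemma IsAnisotropy.contDiffAt_onSphere (hF : IsAnisotropy F m₀ M₀ m₁ m₂) {p : E3} (hp : p ≠ 0) :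
    ContDiffAt ℝ 2 (onSphere F) p := by
  have hn : ‖p‖ ≠ 0 := norm_ne_zero_iff.2 hp
  have h1 : ContDiffAt ℝ 2 (fun p : E3 => ‖p‖⁻¹ • p) p :=
    ((contDiffAt_norm ℝ hp).inv hn).smul contDiffAt_id
  have h2 : ContDiffAt ℝ 2 F ((fun p : E3 => ‖p‖⁻¹ • p) p) :=
    hF.contDiffAt (smul_ne_zero (inv_ne_zero hn) hp)
  exact ContDiffAt.comp (f := fun p : E3 => ‖p‖⁻¹ • p) p h2 h1

lemma IsAnisotropy.eq_norm_mul_onSphere (hF : IsAnisotropy F m₀ M₀ m₁ m₂) {p : E3} (hp : p ≠ 0) :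
    F p = ‖p‖ * onSphere F p := by
  have hn : 0 < ‖p‖ := norm_pos_iff.2 hp
  rw [onSphere, ← hF.homogeneous _ _ hn, smul_smul, mul_inv_cancel₀ hn.ne', one_smul]

/-- Convexity of `F` makes the coefficient matrix nonnegative. -/
lemma IsAnisotropy.sndDeriv_nonneg (hF : IsAnisotropy F m₀ M₀ m₁ m₂) (q w : E2) :
    0 ≤ fderiv ℝ (fderiv ℝ F) (lift q) (horizontal w) (horizontal w) := by
  have hd : ∀ s : ℝ, HasDerivAt (fun s : ℝ => F (lift (q + s • w)))
      (fderiv ℝ F (lift (q + s • w)) (horizontal w)) s := fun s =>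
    hasDerivAt_lift_line q w s
      ((hF.contDiffAt (lift_ne_zero _)).differentiableAt (by norm_num))
  have hconv : ConvexOn ℝ univ (fun s : ℝ => F (lift (q + s • w))) := by
    refine ⟨convex_univ, fun a _ b _ c d hc hd hcd => ?_⟩
    have h1 := hF.convexOn.2 (mem_univ (lift (q + a • w))) (mem_univ (lift (q + b • w))) hc hd hcd
    refine le_of_eq_of_le (congrArg F ?_) h1
    simp only [← lift_add_smul]
    have : lift q = c • lift q + d • lift q := by rw [← add_smul, hcd, one_smul]
    nth_rewrite 1 [this]
    simp only [smul_eq_mul]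
    module
  have hmono := hconv.monotoneOn_deriv (fun s _ => (hd s).differentiableAt)
  have h2 := (hasDerivAt_fderiv_lift_line q w (hF.contDiffAt (lift_ne_zero q))).neg
  have h3 := deriv_nonpos_of_eventually_le h2.hasDerivWithinAt ?_
  · linarith
  · filter_upwards [self_mem_nhdsWithin] with s hs
    have := hmono (mem_univ 0) (mem_univ s) (le_of_lt hs)
    rw [(hd s).deriv, (hd 0).deriv] at this
    simp only [Pi.neg_apply]
    linarith

lemma abs_sum_mul_mul_le (b : Fin 2 → Fin 2 → ℝ) (w : E2) :
    |∑ i : Fin 2, ∑ j : Fin 2, b i j * w i * w j| ≤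
      Real.sqrt (∑ i : Fin 2, ∑ j : Fin 2, b i j ^ 2) * ‖w‖ ^ 2 := by
  have h := Finset.sum_mul_sq_le_sq_mul_sq Finset.univ (fun k : Fin 2 × Fin 2 => b k.1 k.2)
    (fun k => w k.1 * w k.2)
  simp only [Fintype.sum_prod_type] at h
  have hw : ∑ i : Fin 2, ∑ j : Fin 2, (w i * w j) ^ 2 = (‖w‖ ^ 2) ^ 2 := by
    rw [EuclideanSpace.real_norm_sq_eq]
    simp only [Fin.sum_univ_two]
    ring
  rw [hw] at h
  simp only [← mul_assoc] at h
  rw [← Real.sqrt_sq_eq_abs]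
  refine (Real.sqrt_le_sqrt h).trans_eq ?_
  rw [Real.sqrt_mul (by positivity), Real.sqrt_sq (by positivity)]

/-- Ellipticity in the horizontal directions orthogonal to `q`: writing `F = |p| F(ξ)`, the second
derivative of `|p|` contributes `|w|² F(ξ) / |p|`, the mixed terms vanish since `|p|` is stationary
in the direction `w ⟂ q`, and the second derivative of `F(ξ)` is controlled by `m₂`. -/
lemma IsAnisotropy.sndDeriv_ge (hF : IsAnisotropy F m₀ M₀ m₁ m₂) {q w : E2}
    (hqw : inner ℝ q w = 0) :
    (m₀ - m₂) * ‖w‖ ^ 2 / ‖lift q‖ ≤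
      fderiv ℝ (fderiv ℝ F) (lift q) (horizontal w) (horizontal w) := by
  have hp := lift_ne_zero q
  have hp0 : 0 < ‖lift q‖ := norm_pos_iff.2 hp
  set n : ℝ → ℝ := fun s => Real.sqrt (1 + ‖q‖ ^ 2 + s ^ 2 * ‖w‖ ^ 2) with hn
  have hnpos : ∀ s, 0 < n s := fun s => Real.sqrt_pos.2 (by positivity)
  have hnorm : ∀ s : ℝ, ‖lift (q + s • w)‖ = n s := by
    intro s
    rw [norm_lift, hn, norm_add_sq_real, real_inner_smul_right, hqw, norm_smul, mul_pow,
      Real.norm_eq_abs, sq_abs]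
    ring_nf
  have hn0 : n 0 = ‖lift q‖ := by rw [← hnorm 0]; simp
  have hnd : ∀ s, HasDerivAt n (s * ‖w‖ ^ 2 / n s) s := by
    intro s
    have h1 : HasDerivAt (fun s : ℝ => 1 + ‖q‖ ^ 2 + s ^ 2 * ‖w‖ ^ 2) (2 * s * ‖w‖ ^ 2) s := by
      simpa using ((hasDerivAt_pow 2 s).mul_const (‖w‖ ^ 2)).const_add (1 + ‖q‖ ^ 2)
    have h2 := h1.sqrt (by positivity)
    have := (hnpos s).ne'
    have e : s * ‖w‖ ^ 2 / n s = 2 * s * ‖w‖ ^ 2 / (2 * n s) := by field_simp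
    rw [e]
    exact h2
  set φ : ℝ → ℝ := fun s => onSphere F (lift (q + s • w)) with hφ
  set φ' : ℝ → ℝ := fun s => fderiv ℝ (onSphere F) (lift (q + s • w)) (horizontal w) with hφ'
  have hφd : ∀ s, HasDerivAt φ (φ' s) s := fun s =>
    hasDerivAt_lift_line q w s
      ((hF.contDiffAt_onSphere (lift_ne_zero _)).differentiableAt (by norm_num))
  have hψ : ∀ s : ℝ, fderiv ℝ F (lift (q + s • w)) (horizontal w) =
      s * ‖w‖ ^ 2 / n s * φ s + n s * φ' s := by
    intro s
    have h1 := hasDerivAt_lift_line q w s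
      ((hF.contDiffAt (lift_ne_zero _)).differentiableAt (by norm_num))
    have h2 : (fun s : ℝ => F (lift (q + s • w))) = fun s => n s * φ s := by
      funext s
      rw [hF.eq_norm_mul_onSphere (lift_ne_zero _), hnorm]
    rw [h2] at h1
    exact h1.unique ((hnd s).mul (hφd s))
  have h1 := hasDerivAt_fderiv_lift_line q w (hF.contDiffAt hp)
  have h2 := hasDerivAt_fderiv_lift_line q w (hF.contDiffAt_onSphere hp)
  have h3 : HasDerivAt (fun s : ℝ => s * ‖w‖ ^ 2 / n s) (‖w‖ ^ 2 / n 0) 0 := by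
    have h5 := ((hasDerivAt_id (0 : ℝ)).mul_const (‖w‖ ^ 2)).div (hnd 0) (hnpos 0).ne'
    have h6 := (hnpos 0).ne'
    refine h5.congr_deriv ?_
    simp only [id, one_mul, zero_mul, zero_div, mul_zero, sub_zero]
    field_simp
  have h4 := (h3.mul (hφd 0)).add ((hnd 0).mul h2)
  simp only [hψ] at h1
  rw [h1.unique h4]
  have hmφ : m₀ ≤ φ 0 := by
    have : ‖‖lift q‖⁻¹ • lift q‖ = 1 := by
      rw [norm_smul, norm_inv, norm_norm, inv_mul_cancel₀ hp0.ne']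
    simpa [hφ, onSphere] using hF.lower _ this
  have hb := abs_sum_mul_mul_le
    (fun i j => partialD (hor i) (partialD (hor j) (onSphere F)) (lift q)) w
  rw [sum_partialD_partialD (hF.contDiffAt_onSphere hp)] at hb
  have hb2 := (hb.trans (mul_le_mul_of_nonneg_right (hF.second_deriv (lift q) hp).le
    (sq_nonneg ‖w‖)))
  have hb3 := (abs_le.1 hb2).1
  rw [hn0]
  simp only [zero_mul, zero_div, add_zero, zero_add]
  have e1 : (m₀ - m₂) * ‖w‖ ^ 2 / ‖lift q‖ =
      ‖w‖ ^ 2 / ‖lift q‖ * m₀ + ‖lift q‖ * -(m₂ / ‖lift q‖ ^ 2 * ‖w‖ ^ 2) := by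
    field_simp
    ring
  rw [e1]
  gcongr

lemma IsMobility.lift_ge (hG : IsMobility G g₀ G₀) (q : E2) : g₀ * ‖lift q‖ ≤ G (lift q) := by
  have hp0 : 0 < ‖lift q‖ := norm_pos_iff.2 (lift_ne_zero q)
  have h1 : ‖‖lift q‖⁻¹ • lift q‖ = 1 := by
    rw [norm_smul, norm_inv, norm_norm, inv_mul_cancel₀ hp0.ne']
  have h2 := hG.lower _ h1
  rw [hG.homogeneous _ _ (inv_nonneg.2 hp0.le)] at h2
  calc g₀ * ‖lift q‖ ≤ (‖lift q‖⁻¹ * G (lift q)) * ‖lift q‖ := by gcongr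
    _ = G (lift q) := by field_simp

lemma coeff_comm (hF : IsAnisotropy F m₀ M₀ m₁ m₂) (q : E2) (i j : Fin 2) :
    coeff F G q i j = coeff F G q j i := by
  rw [coeff, coeff, partialD_partialD_comm (hF.contDiffAt (lift_ne_zero q))]

lemma sum_coeff (hF : IsAnisotropy F m₀ M₀ m₁ m₂) (q w : E2) :
    ∑ i : Fin 2, ∑ j : Fin 2, coeff F G q i j * w i * w j =
      G (lift q) * fderiv ℝ (fderiv ℝ F) (lift q) (horizontal w) (horizontal w) := by
  rw [← sum_partialD_partialD (hF.contDiffAt (lift_ne_zero q))]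
  simp only [coeff, Fin.sum_univ_two]
  ring

lemma sum_coeff_nonneg (hF : IsAnisotropy F m₀ M₀ m₁ m₂) (hG : IsMobility G g₀ G₀) (hg₀ : 0 < g₀)
    (q w : E2) : 0 ≤ ∑ i : Fin 2, ∑ j : Fin 2, coeff F G q i j * w i * w j := by
  rw [sum_coeff hF]
  exact mul_nonneg ((by positivity : 0 ≤ g₀ * ‖lift q‖).trans (hG.lift_ge q))
    (hF.sndDeriv_nonneg q w)

/-- The growth of the mobility compensates the decay of `D²F`: in the directions orthogonal to `q`
the coefficients are elliptic uniformly in `q`. -/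
lemma le_sum_coeff_of_inner_eq_zero (hF : IsAnisotropy F m₀ M₀ m₁ m₂) (hG : IsMobility G g₀ G₀)
    (hg₀ : 0 < g₀) (hm : m₂ < m₀) {q w : E2} (hqw : inner ℝ q w = 0) :
    g₀ * (m₀ - m₂) * ‖w‖ ^ 2 ≤ ∑ i : Fin 2, ∑ j : Fin 2, coeff F G q i j * w i * w j := by
  have hp0 : 0 < ‖lift q‖ := norm_pos_iff.2 (lift_ne_zero q)
  have hm' : 0 < m₀ - m₂ := by linarith
  rw [sum_coeff hF]
  calc g₀ * (m₀ - m₂) * ‖w‖ ^ 2 = (g₀ * ‖lift q‖) * ((m₀ - m₂) * ‖w‖ ^ 2 / ‖lift q‖) := by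
        field_simp
    _ ≤ _ := mul_le_mul (hG.lift_ge q) (hF.sndDeriv_ge hqw) (by positivity)
        ((by positivity : 0 ≤ g₀ * ‖lift q‖).trans (hG.lift_ge q))

lemma continuous_coeff (hF : IsAnisotropy F m₀ M₀ m₁ m₂) (hG : IsMobility G g₀ G₀)
    (i j : Fin 2) : Continuous fun q => coeff F G q i j := by
  have hmaps : ∀ q, lift q ∈ ({0}ᶜ : Set E3) := fun q => lift_ne_zero q
  have h1 : Continuous fun q => G (lift q) := hG.continuousOn.comp_continuous continuous_lift hmaps
  have h2 : ContDiffOn ℝ 1 (fderiv ℝ F) {0}ᶜ :=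
    hF.contDiffOn.fderiv_of_isOpen isOpen_compl_singleton (by norm_num)
  have h3 : ContinuousOn (fderiv ℝ (fderiv ℝ F)) {0}ᶜ :=
    h2.continuousOn_fderiv_of_isOpen isOpen_compl_singleton (by norm_num)
  have h4 : Continuous fun q => fderiv ℝ (fderiv ℝ F) (lift q) :=
    h3.comp_continuous continuous_lift hmaps
  have h5 : ∀ q, coeff F G q i j = G (lift q) * fderiv ℝ (fderiv ℝ F) (lift q)
      (EuclideanSpace.single (hor i) 1) (EuclideanSpace.single (hor j) 1) := fun q => by
    rw [coeff, partialD_partialD (hF.contDiffAt (lift_ne_zero q))]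
  simp only [h5]
  exact h1.mul ((h4.clm_apply continuous_const).clm_apply continuous_const)

end Anisotropy

/-! ### Algebra of the plane -/

/-- The trace of the product of a nonnegative symmetric matrix and a matrix with nonpositive
quadratic form is nonpositive; `b` need not be symmetric. -/
lemma sum_mul_nonpos {a b : Fin 2 → Fin 2 → ℝ} (hsymm : a 0 1 = a 1 0)
    (ha : ∀ w : E2, 0 ≤ ∑ i : Fin 2, ∑ j : Fin 2, a i j * w i * w j)
    (hb : ∀ w : E2, ∑ i : Fin 2, ∑ j : Fin 2, b i j * w i * w j ≤ 0) :
    ∑ i : Fin 2, ∑ j : Fin 2, a i j * b i j ≤ 0 := by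
  have ha' : ∀ x y : ℝ, 0 ≤ a 0 0 * x ^ 2 + 2 * a 0 1 * x * y + a 1 1 * y ^ 2 := by
    intro x y
    have := ha !₂[x, y]
    simp [Fin.sum_univ_two, ← hsymm] at this
    linarith
  have hb' : ∀ x y : ℝ, b 0 0 * x ^ 2 + (b 0 1 + b 1 0) * x * y + b 1 1 * y ^ 2 ≤ 0 := by
    intro x y
    have := hb !₂[x, y]
    simp [Fin.sum_univ_two] at this
    linarith
  simp only [Fin.sum_univ_two, ← hsymm]
  have h1 := ha' 1 0
  have h2 := hb' 0 1
  rcases (show 0 ≤ a 0 0 by linarith).eq_or_lt with h0 | h0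
  · have hγ := ha' 0 1
    have hβ : a 0 1 = 0 := by
      by_contra hne
      have := ha' (-(a 1 1 + 1) / (2 * a 0 1)) 1
      have e : 2 * a 0 1 * (-(a 1 1 + 1) / (2 * a 0 1)) = -(a 1 1 + 1) := by field_simp
      rw [← h0, e] at this
      linarith
    rw [← h0, hβ]
    have := mul_nonneg (show 0 ≤ a 1 1 by linarith) (show 0 ≤ -b 1 1 by linarith)
    linarith
  · have hdet : 0 ≤ a 0 0 * a 1 1 - a 0 1 ^ 2 := by
      have h3 := ha' (-a 0 1) (a 0 0)
      have h4 : 0 ≤ a 0 0 * (a 0 0 * a 1 1 - a 0 1 ^ 2) := by linarith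
      exact (mul_nonneg_iff_of_pos_left h0).1 h4
    have h3 := hb' (a 0 0) (a 0 1)
    have h4 := mul_nonneg hdet (show 0 ≤ -b 1 1 by linarith)
    have h5 : a 0 0 * ((a 0 0 * b 0 0 + a 0 1 * b 0 1) + (a 0 1 * b 1 0 + a 1 1 * b 1 1)) ≤ 0 := by
      linarith
    by_contra! hcon
    have := mul_pos h0 hcon
    linarith

lemma sum_apply_single_mul_mul (H : E2 →L[ℝ] E2) (w : E2) :
    ∑ i : Fin 2, ∑ j : Fin 2, H (EuclideanSpace.single j 1) i * w i * w j =
      inner ℝ (H w) w := by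
  have hw : w = w 0 • EuclideanSpace.single 0 (1 : ℝ) + w 1 • EuclideanSpace.single 1 (1 : ℝ) := by
    ext i
    fin_cases i <;> simp
  have hH : H w = w 0 • H (EuclideanSpace.single 0 1) + w 1 • H (EuclideanSpace.single 1 1) := by
    nth_rewrite 1 [hw]
    rw [map_add, map_smul, map_smul]
  rw [hH, PiLp.inner_apply]
  simp only [Fin.sum_univ_two, PiLp.add_apply, PiLp.smul_apply, smul_eq_mul, RCLike.inner_apply,
    conj_trivial]
  ring

/-- A linear form that is nonpositive on the open half-plane `{⟪N, ξ⟫ > 0}` is a nonpositive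
multiple of `⟪N, ·⟫`. -/
lemma eq_smul_of_inner_nonpos {d N : E2} (hN : ‖N‖ = 1)
    (h : ∀ ξ : E2, 0 < inner ℝ N ξ → inner ℝ d ξ ≤ 0) :
    d = (inner ℝ d N : ℝ) • N ∧ inner ℝ d N ≤ 0 := by
  have hNN : inner ℝ N N = (1 : ℝ) := by rw [real_inner_self_eq_norm_sq, hN]; norm_num
  set a : ℝ := inner ℝ d N with ha
  set e : E2 := d - a • N with he
  have heN : inner ℝ e N = (0 : ℝ) := by
    rw [he, inner_sub_left, real_inner_smul_left, hNN, ← ha]; ring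
  have hde : inner ℝ d e = ‖e‖ ^ 2 := by
    have : d = e + a • N := by rw [he]; abel
    rw [this, inner_add_left, real_inner_smul_left, real_inner_comm e N, heN,
      real_inner_self_eq_norm_sq]; ring
  have hs : ∀ s : ℝ, a + s * ‖e‖ ^ 2 ≤ 0 := by
    intro s
    have h1 := h (N + s • e) (by
      rw [inner_add_right, real_inner_smul_right, real_inner_comm e N, heN, hNN]; norm_num)
    rwa [inner_add_right, real_inner_smul_right, hde, ← ha] at h1
  have ha0 : a ≤ 0 := by simpa using hs 0
  refine ⟨?_, ha0⟩
  have hz : e = 0 := by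
    by_contra hne
    have hpos : 0 < ‖e‖ ^ 2 := by have := norm_pos_iff.2 hne; positivity
    have := hs ((1 - a) / ‖e‖ ^ 2)
    rw [div_mul_cancel₀ _ hpos.ne'] at this
    linarith
  rw [he, sub_eq_zero] at hz
  exact hz

/-! ### Spatial maxima of differences -/

section Comparison

variable {Ω : Set E2} {ρ θ : E2 → ℝ} {f g : E2 → ℝ} {x : E2}

lemma eventually_le_of_pointsInto {ξ : E2} (hmax : ∀ y ∈ closure Ω, f y - g y ≤ f x - g x)
    (hξ : PointsInto Ω x ξ) :
    ∀ᶠ s in 𝓝[>] (0 : ℝ), f (x + s • ξ) - g (x + s • ξ) ≤ f x - g x := by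
  filter_upwards [hξ] with s hs using hmax _ (subset_closure hs)

/-- At a maximum of `f - g` the gradients agree. At a boundary point this holds because the contact
angle condition determines the normal derivative from the tangential one. -/
lemma grad_eq_of_max (h : IsC3ConvexDomain Ω ρ) (hx : x ∈ closure Ω)
    (hf : DifferentiableOn ℝ f (closure Ω)) (hg : DifferentiableOn ℝ g (closure Ω))
    (hfc : ContactCondition Ω ρ θ f) (hgc : ContactCondition Ω ρ θ g)
    (hmax : ∀ y ∈ closure Ω, f y - g y ≤ f x - g x) : grad Ω f x = grad Ω g x := by
  have key : ∀ ξ, PointsInto Ω x ξ → inner ℝ (grad Ω f x - grad Ω g x) ξ ≤ 0 := by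
    intro ξ hξ
    rw [inner_sub_left, sub_nonpos]
    exact inner_grad_le_of_eventually_le hx hx hf hg hξ hξ (eventually_le_of_pointsInto hmax hξ)
  by_cases hxΩ : x ∈ Ω
  · have h1 := key _ (pointsInto_of_mem h.isOpen hxΩ (grad Ω f x - grad Ω g x))
    rw [real_inner_self_eq_norm_sq] at h1
    have h2 : ‖grad Ω f x - grad Ω g x‖ = 0 := by
      have := norm_nonneg (grad Ω f x - grad Ω g x)
      nlinarith
    exact sub_eq_zero.1 (norm_eq_zero.1 h2)
  · have hxf : x ∈ frontier Ω := by
      rw [h.isOpen.frontier_eq]; exact ⟨hx, hxΩ⟩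
    have hN := norm_innerNormal (h.gradient_ne_zero x (h.eq_zero_of_mem_frontier hxf))
    set N := innerNormal ρ x with hNdef
    obtain ⟨hd, -⟩ := eq_smul_of_inner_nonpos hN
      (fun ξ hξ => key ξ (h.pointsInto_of_inner_pos hxf hξ))
    have e1 := hfc x hxf
    have e2 := hgc x hxf
    rw [← hNdef] at e1 e2
    set p := grad Ω f x
    set q := grad Ω g x
    set c : ℝ := inner ℝ (p - q) N with hc
    have hpq : p = q + c • N := by rw [← hd]; abel
    set S := Real.sqrt (1 + ‖p‖ ^ 2)
    set R := Real.sqrt (1 + ‖q‖ ^ 2)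
    have hS : S ^ 2 = 1 + ‖p‖ ^ 2 := Real.sq_sqrt (by positivity)
    have hR : R ^ 2 = 1 + ‖q‖ ^ 2 := Real.sq_sqrt (by positivity)
    have hS0 : 0 < S := Real.sqrt_pos.2 (by positivity)
    have hR0 : 0 < R := Real.sqrt_pos.2 (by positivity)
    have hnp : ‖p‖ ^ 2 = ‖q‖ ^ 2 + 2 * c * inner ℝ N q + c ^ 2 := by
      rw [hpq, norm_add_sq_real, real_inner_smul_right, norm_smul, hN, real_inner_comm q N,
        Real.norm_eq_abs, mul_one, sq_abs]
      ring
    have hNp : inner ℝ N p = inner ℝ N q + c := by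
      rw [hpq, inner_add_right, real_inner_smul_right, real_inner_self_eq_norm_sq, hN]; ring
    have hqn : inner ℝ N q ^ 2 ≤ ‖q‖ ^ 2 := by
      have := abs_real_inner_le_norm N q
      rw [hN, one_mul] at this
      exact sq_le_sq' (by linarith [(abs_le.1 this).1]) (abs_le.1 this).2
    have hSR : S = R := by
      -- `‖p‖² - ⟪N, p⟫²` and `‖q‖² - ⟪N, q⟫²` are the same squared tangential derivative.
      have h1 : S ^ 2 - S ^ 2 * Real.cos (θ x) ^ 2 = R ^ 2 - R ^ 2 * Real.cos (θ x) ^ 2 := by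
        have t1 : S ^ 2 * Real.cos (θ x) ^ 2 = inner ℝ N p ^ 2 := by rw [e1]; ring
        have t2 : R ^ 2 * Real.cos (θ x) ^ 2 = inner ℝ N q ^ 2 := by rw [e2]; ring
        rw [t1, t2, hNp, hS, hR, hnp]; ring
      have h2 : 0 < R ^ 2 - R ^ 2 * Real.cos (θ x) ^ 2 := by
        have t2 : R ^ 2 * Real.cos (θ x) ^ 2 = inner ℝ N q ^ 2 := by rw [e2]; ring
        rw [t2, hR]; linarith
      have h3 : 0 < 1 - Real.cos (θ x) ^ 2 := by
        have : 0 < R ^ 2 * (1 - Real.cos (θ x) ^ 2) := by linarith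
        exact (mul_pos_iff_of_pos_left (by positivity)).1 this
      have h4 : S ^ 2 = R ^ 2 := by
        have : (1 - Real.cos (θ x) ^ 2) * (S ^ 2 - R ^ 2) = 0 := by linarith
        rcases mul_eq_zero.1 this with h | h <;> linarith
      exact (sq_eq_sq₀ hS0.le hR0.le).1 h4
    have hc0 : c = 0 := by rw [hSR] at e1; linarith
    rw [hpq, hc0, zero_smul, add_zero]

/-- At a maximum of `f - g`, also on the boundary, the Hessians are ordered: the gradients agree
there, so the second order condition holds along all inward directions, and by continuity and
evenness along all directions. -/
lemma hess_le_of_max (h : IsC3ConvexDomain Ω ρ) (hx : x ∈ closure Ω)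
    (hf : DifferentiableOn ℝ f (closure Ω)) (hg : DifferentiableOn ℝ g (closure Ω))
    (hf2 : DifferentiableOn ℝ (grad Ω f) (closure Ω))
    (hg2 : DifferentiableOn ℝ (grad Ω g) (closure Ω))
    (hgrad : grad Ω f x = grad Ω g x)
    (hmax : ∀ y ∈ closure Ω, f y - g y ≤ f x - g x) (ξ : E2) :
    inner ℝ (hess Ω f x ξ) ξ ≤ inner ℝ (hess Ω g x ξ) ξ := by
  have key : ∀ ξ, PointsInto Ω x ξ → inner ℝ (hess Ω f x ξ) ξ ≤ inner ℝ (hess Ω g x ξ) ξ :=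
    fun ξ hξ => inner_hess_le_of_eventually_le h.isOpen hx hx hf hg hf2 hg2 hξ hξ hgrad
      (eventually_le_of_pointsInto hmax hξ)
  by_cases hxΩ : x ∈ Ω
  · exact key _ (pointsInto_of_mem h.isOpen hxΩ _)
  · have hxf : x ∈ frontier Ω := by
      rw [h.isOpen.frontier_eq]; exact ⟨hx, hxΩ⟩
    have hN := norm_innerNormal (h.gradient_ne_zero x (h.eq_zero_of_mem_frontier hxf))
    set N := innerNormal ρ x with hNdef
    have hpos : ∀ ξ, 0 < inner ℝ N ξ → inner ℝ (hess Ω f x ξ) ξ ≤ inner ℝ (hess Ω g x ξ) ξ :=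
      fun ξ hξ => key ξ (h.pointsInto_of_inner_pos hxf hξ)
    have hnonneg : ∀ ξ, 0 ≤ inner ℝ N ξ →
        inner ℝ (hess Ω f x ξ) ξ ≤ inner ℝ (hess Ω g x ξ) ξ := by
      intro ξ hξ
      have hcf : ∀ H : E2 →L[ℝ] E2, Tendsto (fun s : ℝ => inner ℝ (H (ξ + s • N)) (ξ + s • N))
          (𝓝[>] 0) (𝓝 (inner ℝ (H ξ) ξ)) := by
        intro H
        have : ContinuousAt (fun s : ℝ => inner ℝ (H (ξ + s • N)) (ξ + s • N)) 0 := by fun_prop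
        simpa [ContinuousAt] using this.tendsto.mono_left nhdsWithin_le_nhds
      refine le_of_tendsto_of_tendsto (hcf (hess Ω f x)) (hcf (hess Ω g x)) ?_
      filter_upwards [self_mem_nhdsWithin] with s hs
      apply hpos
      rw [inner_add_right, real_inner_smul_right, real_inner_self_eq_norm_sq, hN]
      have : (0 : ℝ) < s := hs
      linarith
    rcases le_total 0 (inner ℝ N ξ) with hξ | hξ
    · exact hnonneg ξ hξ
    · have := hnonneg (-ξ) (by rw [inner_neg_right]; linarith)
      simpa using this

end Comparison

/-- The elliptic operator `∑ a^{ij}(Dw) w_{x_i x_j}` of the flow. -/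
noncomputable def ellipticOp (Ω : Set E2) (F G : E3 → ℝ) (w : E2 → ℝ) (x : E2) : ℝ :=
  ∑ i : Fin 2, ∑ j : Fin 2, coeff F G (grad Ω w x) i j * hessEntry Ω w x i j

section Operator

variable {Ω : Set E2} {F G : E3 → ℝ} {m₀ M₀ m₁ m₂ g₀ G₀ : ℝ} {f g : E2 → ℝ} {x y : E2}

lemma ellipticOp_le (hF : IsAnisotropy F m₀ M₀ m₁ m₂) (hG : IsMobility G g₀ G₀) (hg₀ : 0 < g₀)
    (hgrad : grad Ω f x = grad Ω g y)
    (hhess : ∀ ξ, inner ℝ (hess Ω f x ξ) ξ ≤ inner ℝ (hess Ω g y ξ) ξ) :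
    ellipticOp Ω F G f x ≤ ellipticOp Ω F G g y := by
  have h1 := sum_mul_nonpos (a := coeff F G (grad Ω f x))
    (b := fun i j => (hess Ω f x - hess Ω g y) (EuclideanSpace.single j 1) i)
    (coeff_comm hF _ 0 1) (sum_coeff_nonneg hF hG hg₀ _) (fun w => by
      rw [sum_apply_single_mul_mul, sub_apply, inner_sub_left]
      linarith [hhess w])
  simp only [sub_apply, PiLp.sub_apply, Fin.sum_univ_two] at h1
  simp only [ellipticOp, hessEntry, ← hgrad, Fin.sum_univ_two]
  linarith

lemma ellipticOp_congr (heq : EqOn f g (closure Ω)) (hx : x ∈ closure Ω) :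
    grad Ω f x = grad Ω g x ∧ ellipticOp Ω F G f x = ellipticOp Ω F G g x := by
  have h1 : ∀ y ∈ closure Ω, grad Ω f y = grad Ω g y := fun y hy => by
    rw [grad, grad, gradientWithin, gradientWithin, fderivWithin_congr heq (heq hy)]
  have h2 : hess Ω f x = hess Ω g x := fderivWithin_congr h1 (h1 x hx)
  refine ⟨h1 x hx, ?_⟩
  simp only [ellipticOp, hessEntry, h1 x hx, h2]

lemma grad_add_const (w : E2 → ℝ) (c : ℝ) : grad Ω (fun x => w x + c) = grad Ω w := by
  funext x
  rw [grad, grad, gradientWithin, gradientWithin, fderivWithin_add_const]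

lemma ellipticOp_add_const (w : E2 → ℝ) (c : ℝ) :
    ellipticOp Ω F G (fun x => w x + c) = ellipticOp Ω F G w := by
  funext x
  simp only [ellipticOp, hessEntry, hess, grad_add_const]

lemma continuousOn_ellipticOp (hF : IsAnisotropy F m₀ M₀ m₁ m₂) (hG : IsMobility G g₀ G₀)
    {w : E2 → ℝ} {s : Set E2} (h1 : ContinuousOn (grad Ω w) s) (h2 : ContinuousOn (hess Ω w) s) :
    ContinuousOn (ellipticOp Ω F G w) s := by
  refine continuousOn_finsetSum _ fun i _ => continuousOn_finsetSum _ fun j _ => ?_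
  refine ((continuous_coeff hF hG i j).comp_continuousOn h1).mul ?_
  exact (EuclideanSpace.proj (𝕜 := ℝ) i).continuous.comp_continuousOn
    (h2.clm_apply continuousOn_const)

end Operator

/-! ### Comparison principle and the bound on the time derivative -/

lemma deriv_nonneg_of_max {φ : ℝ → ℝ} {c τ t : ℝ} (ht : 0 < t) (htτ : t ≤ τ)
    (h : HasDerivWithinAt φ c (Icc 0 τ) t) (hmax : ∀ s ∈ Icc 0 τ, φ s ≤ φ t) : 0 ≤ c := by
  have hmax' : IsLocalMaxOn φ (Icc 0 τ) t := by
    filter_upwards [self_mem_nhdsWithin] with s hs using hmax s hs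
  have h1 := hmax'.hasFDerivWithinAt_nonpos h.hasFDerivWithinAt
    (y := 0 - t) (sub_mem_posTangentConeAt_of_segment_subset
      ((convex_Icc 0 τ).segment_subset ⟨ht.le, htτ⟩ ⟨le_rfl, ht.le.trans htτ⟩))
  simp at h1
  by_contra! hc
  have := mul_pos ht (neg_pos.2 hc)
  linarith

lemma abs_le_of_hasDerivWithinAt {φ : ℝ → ℝ} {c C τ t : ℝ} (hτ : 0 < τ) (ht : t ∈ Icc 0 τ)
    (h : HasDerivWithinAt φ c (Icc 0 τ) t)
    (hlip : ∀ s ∈ Icc 0 τ, |φ s - φ t| ≤ C * |s - t|) : |c| ≤ C := by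
  have hne : (𝓝[Icc 0 τ \ {t}] t).NeBot := by
    have h1 := uniqueDiffWithinAt_iff_accPt.1 (uniqueDiffOn_Icc hτ t ht)
    rw [accPt_principal_iff_nhdsWithin] at h1
    exact h1
  rw [hasDerivWithinAt_iff_tendsto_slope] at h
  refine le_of_tendsto h.abs ?_
  filter_upwards [self_mem_nhdsWithin] with s hs
  have hpos : 0 < |s - t| := abs_pos.2 (sub_ne_zero.2 hs.2)
  rw [slope_def_field, abs_div, div_le_iff₀ hpos]
  exact hlip s hs.1

/-- A function `u` on `closure Ω × [0, τ]`, twice differentiable in space up to the boundary,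
with time derivative `ut`, and with the contact angle `θ`; no equation is required. -/
structure IsContactEvolution (Ω : Set E2) (ρ θ : E2 → ℝ) (τ : ℝ) (u ut : E2 → ℝ → ℝ) : Prop where
  diff : ∀ t ∈ Icc 0 τ, DifferentiableOn ℝ (fun x => u x t) (closure Ω)
  diff_grad : ∀ t ∈ Icc 0 τ, DifferentiableOn ℝ (grad Ω (fun x => u x t)) (closure Ω)
  cont : ContinuousOn (fun z : E2 × ℝ => u z.1 z.2) (closure Ω ×ˢ Icc 0 τ)
  time : ∀ x ∈ closure Ω, ∀ t ∈ Icc 0 τ, HasDerivWithinAt (u x) (ut x t) (Icc 0 τ) t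
  contact : ∀ t ∈ Icc 0 τ, ContactCondition Ω ρ θ (fun x => u x t)

section Evolution

variable {Ω : Set E2} {ρ θ : E2 → ℝ} {τ : ℝ} {u ut v vt : E2 → ℝ → ℝ}
  {F G : E3 → ℝ} {m₀ M₀ m₁ m₂ g₀ G₀ : ℝ}

/-- Comparison principle: a subsolution stays below a supersolution. -/
lemma IsContactEvolution.comparison (h : IsC3ConvexDomain Ω ρ)
    (hF : IsAnisotropy F m₀ M₀ m₁ m₂) (hG : IsMobility G g₀ G₀) (hg₀ : 0 < g₀)
    (hu : IsContactEvolution Ω ρ θ τ u ut) (hv : IsContactEvolution Ω ρ θ τ v vt)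
    (hsub : ∀ x ∈ closure Ω, ∀ t ∈ Icc 0 τ,
      ut x t - ellipticOp Ω F G (fun y => u y t) x ≤ vt x t - ellipticOp Ω F G (fun y => v y t) x)
    {c : ℝ} (h0 : ∀ x ∈ closure Ω, u x 0 ≤ v x 0 + c) :
    ∀ x ∈ closure Ω, ∀ t ∈ Icc 0 τ, u x t ≤ v x t + c := by
  intro x hx t ht
  by_contra! hcon
  set ε : ℝ := (u x t - v x t - c) / (2 * (t + 1)) with hε
  have ht0 : 0 ≤ t := ht.1
  have hε0 : 0 < ε := div_pos (by linarith) (by linarith)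
  have hεt : ε * t < u x t - v x t - c := by
    rw [hε, div_mul_eq_mul_div, div_lt_iff₀ (by linarith)]
    have : 0 < u x t - v x t - c := by linarith
    nlinarith
  -- The weight `ε t` makes the differential inequality strict at the maximum.
  have hc : ContinuousOn (fun z : E2 × ℝ => u z.1 z.2 - v z.1 z.2 - ε * z.2)
      (closure Ω ×ˢ Icc 0 τ) := by
    have := hu.cont
    have := hv.cont
    fun_prop
  obtain ⟨⟨x₁, t₁⟩, ⟨hx₁, ht₁⟩, hmax⟩ :=
    (h.isCompact_closure.prod isCompact_Icc).exists_isMaxOn ⟨(x, t), hx, ht⟩ hc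
  have hmax' : ∀ y ∈ closure Ω, ∀ s ∈ Icc 0 τ,
      u y s - v y s - ε * s ≤ u x₁ t₁ - v x₁ t₁ - ε * t₁ := fun y hy s hs =>
    hmax (show (y, s) ∈ closure Ω ×ˢ Icc 0 τ from ⟨hy, hs⟩)
  simp only at hx₁ ht₁
  have ht₁0 : 0 < t₁ := by
    rcases ht₁.1.eq_or_lt with h' | h'
    · exfalso
      have h1 := hmax' x hx t ht
      rw [← h'] at h1
      have h2 := h0 x₁ hx₁
      linarith
    · exact h'
  have hspace : ∀ y ∈ closure Ω, u y t₁ - v y t₁ ≤ u x₁ t₁ - v x₁ t₁ := fun y hy => by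
    linarith [hmax' y hy t₁ ht₁]
  have hgrad := grad_eq_of_max h hx₁ (hu.diff t₁ ht₁) (hv.diff t₁ ht₁) (hu.contact t₁ ht₁)
    (hv.contact t₁ ht₁) hspace
  have hhess := hess_le_of_max h hx₁ (hu.diff t₁ ht₁) (hv.diff t₁ ht₁) (hu.diff_grad t₁ ht₁)
    (hv.diff_grad t₁ ht₁) hgrad hspace
  have hop := ellipticOp_le hF hG hg₀ hgrad hhess
  have htime : HasDerivWithinAt (fun s => u x₁ s - v x₁ s - ε * s) (ut x₁ t₁ - vt x₁ t₁ - ε)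
      (Icc 0 τ) t₁ := by
    have h1 := ((hasDerivWithinAt_id t₁ (Icc 0 τ)).const_mul ε)
    rw [mul_one] at h1
    exact ((hu.time x₁ hx₁ t₁ ht₁).sub (hv.time x₁ hx₁ t₁ ht₁)).sub h1
  have h1 := deriv_nonneg_of_max ht₁0 ht₁.2 htime (fun s hs => hmax' x₁ hx₁ s hs)
  have h2 := hsub x₁ hx₁ t₁ ht₁
  linarith

lemma IsContactEvolution.mono (hu : IsContactEvolution Ω ρ θ τ u ut) {σ : ℝ} (hσ : σ ≤ τ) :
    IsContactEvolution Ω ρ θ σ u ut where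
  diff t ht := hu.diff t ⟨ht.1, ht.2.trans hσ⟩
  diff_grad t ht := hu.diff_grad t ⟨ht.1, ht.2.trans hσ⟩
  cont := hu.cont.mono (prod_mono le_rfl (Icc_subset_Icc_right hσ))
  time x hx t ht := (hu.time x hx t ⟨ht.1, ht.2.trans hσ⟩).mono (Icc_subset_Icc_right hσ)
  contact t ht := hu.contact t ⟨ht.1, ht.2.trans hσ⟩

lemma IsContactEvolution.shift (hu : IsContactEvolution Ω ρ θ τ u ut) {k : ℝ} (hk : 0 ≤ k) :
    IsContactEvolution Ω ρ θ (τ - k) (fun x t => u x (t + k)) (fun x t => ut x (t + k)) := by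
  have hmaps : MapsTo (fun t => t + k) (Icc 0 (τ - k)) (Icc 0 τ) := fun t ht =>
    ⟨by linarith [ht.1], by linarith [ht.2]⟩
  refine ⟨fun t ht => hu.diff _ (hmaps ht), fun t ht => hu.diff_grad _ (hmaps ht), ?_, ?_,
    fun t ht => hu.contact _ (hmaps ht)⟩
  · refine hu.cont.comp (f := fun z : E2 × ℝ => (z.1, z.2 + k)) (by fun_prop) ?_
    exact fun z hz => ⟨hz.1, hmaps hz.2⟩
  · intro x hx t ht
    have h1 := (hu.time x hx _ (hmaps ht)).comp t
      ((hasDerivWithinAt_id t (Icc 0 (τ - k))).add_const k) hmaps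
    rw [mul_one] at h1
    exact h1

lemma isContactEvolution_add_mul {w : E2 → ℝ} (hw : DifferentiableOn ℝ w (closure Ω))
    (hw2 : DifferentiableOn ℝ (grad Ω w) (closure Ω)) (hc : ContactCondition Ω ρ θ w) (C τ : ℝ) :
    IsContactEvolution Ω ρ θ τ (fun x t => w x + C * t) (fun _ _ => C) := by
  refine ⟨fun t _ => hw.add_const _, fun t _ => by rwa [grad_add_const], ?_, ?_, fun t _ => ?_⟩
  · have h1 : ContinuousOn (fun z : E2 × ℝ => w z.1) (closure Ω ×ˢ Icc 0 τ) :=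
      hw.continuousOn.comp continuousOn_fst (fun z hz => hz.1)
    exact h1.add (continuous_const.mul continuous_snd).continuousOn
  · intro x _ t _
    have h1 := ((hasDerivWithinAt_id t (Icc 0 τ)).const_mul C).const_add (w x)
    rwa [mul_one] at h1
  · intro x hx
    rw [grad_add_const]
    exact hc x hx

end Evolution

section Solution

variable {Ω : Set E2} {ρ θ : E2 → ℝ} {τ : ℝ} {u : E2 → ℝ → ℝ} {u₀ : E2 → ℝ}
  {F G : E3 → ℝ} {m₀ M₀ m₁ m₂ g₀ G₀ : ℝ}

lemma IsSolution.isContactEvolution (hu : IsSolution Ω ρ θ F G u₀ τ u) :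
    IsContactEvolution Ω ρ θ τ u (timeDeriv τ u) where
  diff := hu.regular.differentiableOn
  diff_grad := hu.regular.differentiableOn_grad
  cont := hu.regular.continuousOn
  time x hx t ht := (hu.regular.differentiableOn_time x hx t ht).hasDerivWithinAt
  contact := hu.boundary

/-- By continuity the equation holds up to the boundary. -/
lemma IsSolution.equation_closure (hF : IsAnisotropy F m₀ M₀ m₁ m₂) (hG : IsMobility G g₀ G₀)
    (hu : IsSolution Ω ρ θ F G u₀ τ u) {t : ℝ} (ht : t ∈ Icc 0 τ) :
    ∀ x ∈ closure Ω, timeDeriv τ u x t = ellipticOp Ω F G (fun y => u y t) x := by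
  have hslice : ContinuousOn (fun x : E2 => (x, t)) (closure Ω) := by fun_prop
  have hmaps : MapsTo (fun x : E2 => (x, t)) (closure Ω) (closure Ω ×ˢ Icc 0 τ) :=
    fun x hx => ⟨hx, ht⟩
  have h1 : ContinuousOn (fun x => timeDeriv τ u x t) (closure Ω) :=
    hu.regular.continuousOn_time.comp hslice hmaps
  have h2 : ContinuousOn (grad Ω (fun y => u y t)) (closure Ω) :=
    hu.regular.continuousOn_grad.comp hslice hmaps
  have h3 : ContinuousOn (hess Ω (fun y => u y t)) (closure Ω) :=
    hu.regular.continuousOn_hess.comp hslice hmaps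
  have h4 : ContinuousOn (ellipticOp Ω F G (fun y => u y t)) (closure Ω) :=
    continuousOn_ellipticOp hF hG h2 h3
  have h5 : EqOn (fun x => timeDeriv τ u x t) (ellipticOp Ω F G (fun y => u y t)) Ω :=
    fun x hx => hu.equation x hx t ht
  exact h5.of_subset_closure h1 h4 subset_closure le_rfl

lemma IsSolution.initial_closure (hτ : 0 < τ) (h₀ : ContinuousOn u₀ (closure Ω))
    (hu : IsSolution Ω ρ θ F G u₀ τ u) : EqOn (fun x => u x 0) u₀ (closure Ω) := by
  have h0 : (0 : ℝ) ∈ Icc 0 τ := ⟨le_rfl, hτ.le⟩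
  have h1 : ContinuousOn (fun x => u x 0) (closure Ω) :=
    (hu.regular.differentiableOn 0 h0).continuousOn
  have h2 : EqOn (fun x => u x 0) u₀ Ω := hu.initial
  exact h2.of_subset_closure h1 h₀ subset_closure le_rfl

/-- The time derivative is bounded by its initial size: comparison with `u₀ ± C t` controls
`u(·, k) - u₀`, and comparison of `u` with its time shifts propagates this control. -/
lemma IsSolution.abs_timeDeriv_le (h : IsC3ConvexDomain Ω ρ)
    (hF : IsAnisotropy F m₀ M₀ m₁ m₂) (hG : IsMobility G g₀ G₀) (hg₀ : 0 < g₀) (hτ : 0 < τ)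
    (h₀ : ContinuousOn u₀ (closure Ω)) (hu : IsSolution Ω ρ θ F G u₀ τ u) {C : ℝ}
    (hC : ∀ x ∈ closure Ω, |ellipticOp Ω F G u₀ x| ≤ C) :
    ∀ x ∈ closure Ω, ∀ t ∈ Icc 0 τ, |timeDeriv τ u x t| ≤ C := by
  have h0 : (0 : ℝ) ∈ Icc 0 τ := ⟨le_rfl, hτ.le⟩
  have hE := hu.isContactEvolution
  have hop : ∀ x ∈ closure Ω, |ellipticOp Ω F G (fun y => u y 0) x| ≤ C := fun x hx => by
    rw [(ellipticOp_congr (hu.initial_closure hτ h₀) hx).2]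
    exact hC x hx
  have hbar := fun C' : ℝ => isContactEvolution_add_mul (hE.diff 0 h0) (hE.diff_grad 0 h0)
    (hE.contact 0 h0) C' τ
  have hzero : ∀ x ∈ closure Ω, ∀ t ∈ Icc 0 τ,
      timeDeriv τ u x t - ellipticOp Ω F G (fun y => u y t) x = 0 := fun x hx t ht =>
    sub_eq_zero.2 (hu.equation_closure hF hG ht x hx)
  have hup : ∀ x ∈ closure Ω, ∀ t ∈ Icc 0 τ, u x t ≤ (u x 0 + C * t) + 0 :=
    hE.comparison h hF hG hg₀ (hbar C) (fun x hx t ht => by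
      rw [hzero x hx t ht, ellipticOp_add_const]
      linarith [(abs_le.1 (hop x hx)).2]) (by simp)
  have hlo : ∀ x ∈ closure Ω, ∀ t ∈ Icc 0 τ, u x 0 + (-C) * t ≤ u x t + 0 :=
    (hbar (-C)).comparison h hF hG hg₀ hE (fun x hx t ht => by
      rw [hzero x hx t ht, ellipticOp_add_const]
      linarith [(abs_le.1 (hop x hx)).1]) (by simp)
  have hlip : ∀ x ∈ closure Ω, ∀ s ∈ Icc 0 τ, ∀ t ∈ Icc 0 τ, s ≤ t →
      |u x t - u x s| ≤ C * (t - s) := by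
    intro x hx s hs t ht hst
    have hk0 : 0 ≤ t - s := by linarith
    have hkτ : t - s ∈ Icc 0 τ := ⟨hk0, by linarith [hs.1, ht.2]⟩
    have hs' : s ∈ Icc 0 (τ - (t - s)) := ⟨hs.1, by linarith [ht.2]⟩
    have hE1 := hE.shift hk0
    have hE2 := hE.mono (σ := τ - (t - s)) (by linarith)
    have hin1 : ∀ r ∈ Icc 0 (τ - (t - s)), r ∈ Icc 0 τ := fun r hr => ⟨hr.1, by linarith [hr.2]⟩
    have hin2 : ∀ r ∈ Icc 0 (τ - (t - s)), r + (t - s) ∈ Icc 0 τ :=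
      fun r hr => ⟨by linarith [hr.1], by linarith [hr.2]⟩
    have h1 := hE1.comparison h hF hG hg₀ hE2 (c := C * (t - s)) (fun y hy r hr => by
      rw [hzero y hy r (hin1 r hr), hzero y hy _ (hin2 r hr)]) (fun y hy => by
        have := hup y hy _ hkτ
        simp only [zero_add]
        linarith) x hx s hs'
    have h2 := hE2.comparison h hF hG hg₀ hE1 (c := C * (t - s)) (fun y hy r hr => by
      rw [hzero y hy r (hin1 r hr), hzero y hy _ (hin2 r hr)]) (fun y hy => by
        have := hlo y hy _ hkτ
        simp only [zero_add]
        linarith) x hx s hs'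
    simp only [add_sub_cancel] at h1 h2
    rw [abs_le]
    constructor <;> linarith
  intro x hx t ht
  refine abs_le_of_hasDerivWithinAt hτ ht (hE.time x hx t ht) (fun s hs => ?_)
  rcases le_total s t with hst | hst
  · rw [abs_sub_comm, abs_sub_comm s t, abs_of_nonneg (sub_nonneg.2 hst)]
    exact hlip x hx s hs t ht hst
  · rw [abs_of_nonneg (sub_nonneg.2 hst)]
    exact hlip x hx t ht s hs hst

end Solution

/-! ### Reduction of the gradient bound to the parabolic boundary -/

lemma sub_le_of_norm_grad_le {Ω : Set E2} (hconv : Convex ℝ Ω) {f : E2 → ℝ}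
    (hf : DifferentiableOn ℝ f (closure Ω)) {y z : E2} (hy : y ∈ closure Ω) (hz : z ∈ closure Ω)
    {C : ℝ} (hC : ∀ w ∈ segment ℝ y z, ‖grad Ω f w‖ ≤ C) : f z - f y ≤ C * ‖z - y‖ := by
  have hsub : segment ℝ y z ⊆ closure Ω := hconv.closure.segment_subset hy hz
  have h1 := (convex_segment y z).norm_image_sub_le_of_norm_hasFDerivWithin_le
    (f := f) (C := C) (f' := fun w => InnerProductSpace.toDual ℝ E2 (grad Ω f w))
    (fun w hw => (hasFDerivWithinAt_of_grad (hf w (hsub hw))).mono hsub)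
    (fun w hw => by rw [LinearIsometryEquiv.norm_map]; exact hC w hw)
    (left_mem_segment ℝ y z) (right_mem_segment ℝ y z)
  exact (le_abs_self _).trans h1

section Solution

variable {Ω : Set E2} {ρ θ : E2 → ℝ} {τ : ℝ} {u : E2 → ℝ → ℝ} {u₀ : E2 → ℝ}
  {F G : E3 → ℝ} {m₀ M₀ m₁ m₂ g₀ G₀ : ℝ}

/-- A difference `u(· + k) - u` at a fixed time cannot have an interior maximum at which it is
strictly increasing in time, since the equation is invariant under translations. -/
lemma IsSolution.timeDeriv_le_of_max_translate (h : IsC3ConvexDomain Ω ρ)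
    (hF : IsAnisotropy F m₀ M₀ m₁ m₂) (hG : IsMobility G g₀ G₀) (hg₀ : 0 < g₀)
    (hu : IsSolution Ω ρ θ F G u₀ τ u) {t : ℝ} (ht : t ∈ Icc 0 τ) {y k : E2} (hy : y ∈ Ω)
    (hyk : y + k ∈ Ω)
    (hmax : ∀ z ∈ Ω, z + k ∈ Ω → u (z + k) t - u z t ≤ u (y + k) t - u y t) :
    timeDeriv τ u (y + k) t ≤ timeDeriv τ u y t := by
  have hE := hu.isContactEvolution
  have hle : ∀ ξ : E2, ∀ᶠ s in 𝓝[>] (0 : ℝ),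
      u (y + k + s • ξ) t - u (y + s • ξ) t ≤ u (y + k) t - u y t := by
    intro ξ
    filter_upwards [pointsInto_of_mem h.isOpen hy ξ, pointsInto_of_mem h.isOpen hyk ξ]
      with s h1 h2
    rw [add_right_comm] at h2 ⊢
    exact hmax _ h1 h2
  have hgrad : grad Ω (fun x => u x t) (y + k) = grad Ω (fun x => u x t) y := by
    set d := grad Ω (fun x => u x t) (y + k) - grad Ω (fun x => u x t) y with hd
    have h1 := inner_grad_le_of_eventually_le (f := fun x => u x t) (g := fun x => u x t)
      (subset_closure hyk) (subset_closure hy) (hE.diff t ht) (hE.diff t ht)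
      (pointsInto_of_mem h.isOpen hyk d) (pointsInto_of_mem h.isOpen hy d) (hle d)
    rw [← sub_nonpos, ← inner_sub_left, ← hd, real_inner_self_eq_norm_sq] at h1
    have h2 : ‖d‖ = 0 := by
      have := norm_nonneg d
      nlinarith
    exact sub_eq_zero.1 (norm_eq_zero.1 h2)
  have hhess := fun ξ => inner_hess_le_of_eventually_le (f := fun x => u x t)
    (g := fun x => u x t) h.isOpen
    (subset_closure hyk) (subset_closure hy) (hE.diff t ht) (hE.diff t ht)
    (hE.diff_grad t ht) (hE.diff_grad t ht)
    (pointsInto_of_mem h.isOpen hyk ξ) (pointsInto_of_mem h.isOpen hy ξ) hgrad (hle ξ)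
  rw [hu.equation_closure hF hG ht _ (subset_closure hyk),
    hu.equation_closure hF hG ht _ (subset_closure hy)]
  exact ellipticOp_le hF hG hg₀ hgrad hhess

/-- The gradient is bounded by its values on the parabolic boundary. The maximum principle is
applied to difference quotients, as the equation cannot be differentiated. -/
lemma IsSolution.norm_grad_le (h : IsC3ConvexDomain Ω ρ)
    (hF : IsAnisotropy F m₀ M₀ m₁ m₂) (hG : IsMobility G g₀ G₀) (hg₀ : 0 < g₀)
    (hu : IsSolution Ω ρ θ F G u₀ τ u) {M : ℝ}
    (hM : ∀ x ∈ frontier Ω, ∀ t ∈ Icc 0 τ, ‖grad Ω (fun y => u y t) x‖ ≤ M)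
    (hM0 : ∀ x ∈ closure Ω, ‖grad Ω (fun y => u y 0) x‖ ≤ M) :
    ∀ x ∈ closure Ω, ∀ t ∈ Icc 0 τ, ‖grad Ω (fun y => u y t) x‖ ≤ M := by
  have hE := hu.isContactEvolution
  intro x hx t ht
  by_contra! hcon
  have hxΩ : x ∈ Ω := by
    by_contra hxΩ
    have hxf : x ∈ frontier Ω := by rw [h.isOpen.frontier_eq]; exact ⟨hx, hxΩ⟩
    linarith [hM x hxf t ht]
  have hMnn : 0 ≤ M := (norm_nonneg _).trans (hM0 x hx)
  set p := grad Ω (fun y => u y t) x with hp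
  have hp0 : 0 < ‖p‖ := hMnn.trans_lt hcon
  set ε := (‖p‖ - M) / 3 with hε
  have hε0 : 0 < ε := by rw [hε]; linarith
  obtain ⟨η, hη0, hη⟩ := Metric.uniformContinuousOn_iff.1
    ((h.isCompact_closure.prod isCompact_Icc).uniformContinuousOn_of_continuous
      hu.regular.continuousOn_grad) ε hε0
  have hnear : ∀ r ∈ Icc 0 τ, ∀ z ∈ closure Ω, ∀ y ∈ frontier Ω, dist z y < η →
      ‖grad Ω (fun y => u y r) z‖ ≤ M + ε := by
    intro r hr z hz y hy hzy
    have h1 := hη (z, r) ⟨hz, hr⟩ (y, r) ⟨frontier_subset_closure hy, hr⟩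
      (by simpa [Prod.dist_eq] using hzy)
    rw [dist_eq_norm] at h1
    have h2 := hM y hy r hr
    have h3 := norm_sub_norm_le (grad Ω (fun y => u y r) z) (grad Ω (fun y => u y r) y)
    simp only at h1
    linarith
  -- A step `k` in the direction of `Du(x, t)` over which the difference quotient exceeds `M + 2ε`.
  set e : E2 := ‖p‖⁻¹ • p with he
  have hen : ‖e‖ = 1 := by rw [he, norm_smul, norm_inv, norm_norm, inv_mul_cancel₀ hp0.ne']
  have hpe : inner ℝ p e = M + 3 * ε := by
    rw [he, real_inner_smul_right, real_inner_self_eq_norm_sq, hε]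
    field_simp
    ring
  have hpi := pointsInto_of_mem h.isOpen hxΩ e
  obtain ⟨s, hs0, hsη, hsΩ, hsu⟩ : ∃ s : ℝ, 0 < s ∧ s < η ∧ x + s • e ∈ Ω ∧
      s * (M + 2 * ε) < u (x + s • e) t - u x t := by
    have h1 := hpi.hasDerivWithinAt (hasFDerivWithinAt_of_grad (hE.diff t ht x hx))
    have h2 := h1.sub ((hasDerivWithinAt_id (0 : ℝ) (Ioi 0)).mul_const (M + 2 * ε))
    have h3 := eventually_pos_of_deriv_pos h2 (by
      rw [InnerProductSpace.toDual_apply_apply, ← hp, hpe]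
      linarith)
    have h4 : ∀ᶠ s in 𝓝[>] (0 : ℝ), s < η :=
      (eventually_lt_nhds hη0).filter_mono nhdsWithin_le_nhds
    obtain ⟨s, ⟨⟨h5, h6⟩, h7⟩, h8⟩ := (((hpi.and h3).and h4).and self_mem_nhdsWithin).exists
    refine ⟨s, h8, h7, h5, ?_⟩
    simp only [Pi.sub_apply, id, zero_smul, add_zero, zero_mul] at h6
    linarith
  set k := s • e with hk
  have hkn : ‖k‖ = s := by rw [hk, norm_smul, hen, mul_one, Real.norm_eq_abs, abs_of_pos hs0]
  set D := u (x + k) t - u x t - s * (M + 2 * ε) with hD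
  have hD0 : 0 < D := by rw [hD]; linarith
  have ht0 : 0 ≤ t := ht.1
  -- The weight `κ r` makes the comparison strict, and is small enough not to spoil the gain `D`.
  set κ := D / (t + 1) with hκ
  have hκ0 : 0 < κ := div_pos hD0 (by linarith)
  have hκt : κ * t < D := by
    rw [hκ, div_mul_eq_mul_div, div_lt_iff₀ (by linarith)]
    linarith
  set K : Set E2 := closure Ω ∩ (fun y => y + k) ⁻¹' closure Ω with hK
  have hKc : IsCompact K :=
    h.isCompact_closure.inter_right (isClosed_closure.preimage (by fun_prop))
  have hc : ContinuousOn (fun z : E2 × ℝ => u (z.1 + k) z.2 - u z.1 z.2 - κ * z.2)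
      (K ×ˢ Icc 0 τ) := by
    have h1 : ContinuousOn (fun z : E2 × ℝ => u (z.1 + k) z.2) (K ×ˢ Icc 0 τ) :=
      hE.cont.comp (f := fun z : E2 × ℝ => (z.1 + k, z.2)) (by fun_prop)
        (fun z hz => ⟨hz.1.2, hz.2⟩)
    have h2 : ContinuousOn (fun z : E2 × ℝ => u z.1 z.2) (K ×ˢ Icc 0 τ) :=
      hE.cont.mono (prod_mono inter_subset_left le_rfl)
    exact (h1.sub h2).sub (continuous_const.mul continuous_snd).continuousOn
  obtain ⟨⟨y, r⟩, ⟨hyK, hr⟩, hmax⟩ := (hKc.prod isCompact_Icc).exists_isMaxOn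
    ⟨(x, t), ⟨hx, subset_closure hsΩ⟩, ht⟩ hc
  simp only at hyK hr
  have hmax' : ∀ z ∈ K, ∀ q ∈ Icc 0 τ,
      u (z + k) q - u z q - κ * q ≤ u (y + k) r - u y r - κ * r := fun z hz q hq =>
    hmax (show (z, q) ∈ K ×ˢ Icc 0 τ from ⟨hz, hq⟩)
  have hbig : s * (M + 2 * ε) < u (y + k) r - u y r := by
    have h1 := hmax' x ⟨hx, subset_closure hsΩ⟩ t ht
    have h2 := mul_nonneg hκ0.le hr.1
    linarith
  have hmean : ∀ C, (∀ w ∈ segment ℝ y (y + k), ‖grad Ω (fun y => u y r) w‖ ≤ C) →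
      u (y + k) r - u y r ≤ C * s := fun C hC => by
    have := sub_le_of_norm_grad_le h.convex (hE.diff r hr) hyK.1 hyK.2 hC
    rwa [add_sub_cancel_left, hkn] at this
  have hseg : ∀ w ∈ segment ℝ y (y + k), w ∈ closure Ω ∧ dist w y < η ∧ dist w (y + k) < η := by
    intro w hw
    refine ⟨h.convex.closure.segment_subset hyK.1 hyK.2 hw, ?_, ?_⟩
    · have := (convex_closedBall y s).segment_subset (Metric.mem_closedBall_self hs0.le)
        (by simp [hkn]) hw
      exact (Metric.mem_closedBall.1 this).trans_lt hsη
    · have := (convex_closedBall (y + k) s).segment_subset (by simp [dist_eq_norm, hkn])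
        (Metric.mem_closedBall_self hs0.le) hw
      exact (Metric.mem_closedBall.1 this).trans_lt hsη
  have hsε : 0 < s * ε := mul_pos hs0 hε0
  have hr0 : 0 < r := by
    rcases hr.1.eq_or_lt with h' | h'
    · exfalso
      have := hmean M (fun w hw => by rw [← h']; exact hM0 w (hseg w hw).1)
      linarith
    · exact h'
  have hyΩ : y ∈ Ω := by
    by_contra hn
    have hyf : y ∈ frontier Ω := by rw [h.isOpen.frontier_eq]; exact ⟨hyK.1, hn⟩
    have := hmean (M + ε) (fun w hw => hnear r hr w (hseg w hw).1 y hyf (hseg w hw).2.1)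
    linarith
  have hykΩ : y + k ∈ Ω := by
    by_contra hn
    have hyf : y + k ∈ frontier Ω := by rw [h.isOpen.frontier_eq]; exact ⟨hyK.2, hn⟩
    have := hmean (M + ε) (fun w hw => hnear r hr w (hseg w hw).1 _ hyf (hseg w hw).2.2)
    linarith
  have h1 := hu.timeDeriv_le_of_max_translate h hF hG hg₀ hr hyΩ hykΩ (fun z hz hzk => by
    linarith [hmax' z ⟨subset_closure hz, subset_closure hzk⟩ r hr])
  have htime : HasDerivWithinAt (fun q => u (y + k) q - u y q - κ * q)
      (timeDeriv τ u (y + k) r - timeDeriv τ u y r - κ) (Icc 0 τ) r := by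
    have h2 := ((hasDerivWithinAt_id r (Icc 0 τ)).const_mul κ)
    rw [mul_one] at h2
    exact ((hE.time _ hyK.2 r hr).sub (hE.time _ hyK.1 r hr)).sub h2
  have h2 := deriv_nonneg_of_max hr0 hr.2 htime (fun q hq => hmax' y hyK q hq)
  linarith

end Solution

/-! ### The boundary frame and the differentiated contact condition -/

lemma inner_unitTangent_innerNormal (ρ : E2 → ℝ) (x : E2) :
    inner ℝ (unitTangent ρ x) (innerNormal ρ x) = 0 := by
  simp [unitTangent, PiLp.inner_apply, Fin.sum_univ_two]
  ring

lemma eq_add_of_frame {ρ : E2 → ℝ} {x : E2} (hx : gradient ρ x ≠ 0) (ξ : E2) :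
    ξ = (inner ℝ ξ (unitTangent ρ x) : ℝ) • unitTangent ρ x +
      (inner ℝ ξ (innerNormal ρ x) : ℝ) • innerNormal ρ x := by
  have h1 : innerNormal ρ x 0 ^ 2 + innerNormal ρ x 1 ^ 2 = 1 := by
    have := norm_innerNormal hx
    rw [← sq_eq_sq₀ (norm_nonneg _) zero_le_one, EuclideanSpace.real_norm_sq_eq,
      Fin.sum_univ_two] at this
    linarith
  set N := innerNormal ρ x with hN
  ext i
  fin_cases i
  · simp [unitTangent, ← hN, PiLp.inner_apply, Fin.sum_univ_two]
    linear_combination (-ξ 0) * h1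
  · simp [unitTangent, ← hN, PiLp.inner_apply, Fin.sum_univ_two]
    linear_combination (-ξ 1) * h1

lemma norm_unitTangent {ρ : E2 → ℝ} {x : E2} (hx : gradient ρ x ≠ 0) :
    ‖unitTangent ρ x‖ = 1 := by
  rw [← norm_innerNormal hx, EuclideanSpace.norm_eq, EuclideanSpace.norm_eq]
  congr 1
  simp [unitTangent, Fin.sum_univ_two]
  ring

lemma fderiv_unitTangent {ρ : E2 → ℝ} {x : E2} (hx : gradient ρ x ≠ 0) :
    fderiv ℝ ρ x (unitTangent ρ x) = 0 := by
  have h1 := inner_innerNormal (ρ := ρ) x (unitTangent ρ x)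
  rw [real_inner_comm, inner_unitTangent_innerNormal, eq_comm, neg_eq_zero] at h1
  exact (mul_eq_zero.1 h1).resolve_left (inv_ne_zero (norm_ne_zero_iff.2 hx))

/-- The Riesz isomorphism from the dual of the plane to the plane, as a linear (rather than
conjugate-linear) map. -/
noncomputable def rieszMap : StrongDual ℝ E2 →L[ℝ] E2 :=
  (InnerProductSpace.toDual ℝ E2).symm.toContinuousLinearEquiv.toContinuousLinearMap

/-- The Frenet formula `D_T N = -k T`. -/
lemma IsC3ConvexDomain.hasFDerivAt_innerNormal {Ω : Set E2} {ρ : E2 → ℝ}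
    (h : IsC3ConvexDomain Ω ρ) {x : E2} (hx : gradient ρ x ≠ 0) :
    ∃ N' : E2 →L[ℝ] E2, HasFDerivAt (innerNormal ρ) N' x ∧
      N' (unitTangent ρ x) = -curvature ρ x • unitTangent ρ x := by
  have hD : DifferentiableAt ℝ (fderiv ℝ ρ) x :=
    ((h.contDiff.fderiv_right (m := 2) (by norm_num)).differentiable (by norm_num)) x
  set A := fderiv ℝ (fderiv ℝ ρ) x with hA
  set g' : E2 →L[ℝ] E2 := rieszMap.comp A with hg'
  have hg : HasFDerivAt (gradient ρ) g' x :=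
    rieszMap.hasFDerivAt.comp x hD.hasFDerivAt
  have hg'A : ∀ ξ ζ, inner ℝ (g' ξ) ζ = A ξ ζ := fun ξ ζ =>
    InnerProductSpace.toDual_symm_apply (𝕜 := ℝ) (x := ζ) (y := A ξ)
  have hcd : DifferentiableAt ℝ (fun y => ‖gradient ρ y‖⁻¹) x :=
    (hg.differentiableAt.norm ℝ hx).inv (norm_ne_zero_iff.2 hx)
  have hN := (hcd.hasFDerivAt.smul hg).neg
  set T := unitTangent ρ x with hT
  refine ⟨_, hN, ?_⟩
  set N' := -(‖gradient ρ x‖⁻¹ • g' + (fderiv ℝ (fun y => ‖gradient ρ y‖⁻¹) x).smulRight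
    (gradient ρ x)) with hN'
  have hN2 : HasFDerivAt (innerNormal ρ) N' x := hN
  have hgT : inner ℝ (gradient ρ x) T = 0 := by
    rw [inner_gradient_left]; exact fderiv_unitTangent hx
  have e1 : inner ℝ (N' T) T = -curvature ρ x := by
    simp only [hN', neg_apply, add_apply, smul_apply, ContinuousLinearMap.smulRight_apply,
      inner_neg_left, inner_add_left, real_inner_smul_left, hg'A, hgT, curvature, ← hA, ← hT]
    ring
  have e2 : inner ℝ (N' T) (innerNormal ρ x) = 0 := by
    -- `|N| = 1` near `x`.
    have h1 := hN2.norm_sq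
    have h2 : (fun y => ‖innerNormal ρ y‖ ^ 2) =ᶠ[𝓝 x] fun _ => (1 : ℝ) := by
      filter_upwards [hg.continuousAt.eventually_ne hx] with y hy
      rw [norm_innerNormal hy, one_pow]
    have h3 := (h1.congr_of_eventuallyEq h2.symm).unique (hasFDerivAt_const (1 : ℝ) x)
    have h4 := congrArg (fun l : E2 →L[ℝ] ℝ => l T) h3
    simp at h4
    rw [real_inner_comm]
    exact h4
  have h5 := eq_add_of_frame hx (N' T)
  rw [← hT, e1, e2, zero_smul, add_zero] at h5
  exact h5

section Boundary

variable {Ω : Set E2} {ρ θ : E2 → ℝ} {δ₀ θ₀ : ℝ} {f : E2 → ℝ} {x : E2}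

/-- Differentiating the contact angle condition along the boundary. -/
lemma tangential_contact (h : IsC3ConvexDomain Ω ρ) (hθ : IsContactAngle Ω ρ θ δ₀ θ₀)
    (hx : x ∈ frontier Ω) (hf2 : DifferentiableOn ℝ (grad Ω f) (closure Ω))
    (hfc : ContactCondition Ω ρ θ f) :
    inner ℝ (innerNormal ρ x) (hess Ω f x (unitTangent ρ x))
      - curvature ρ x * inner ℝ (unitTangent ρ x) (grad Ω f x)
      + inner ℝ (grad Ω f x) (hess Ω f x (unitTangent ρ x)) / Real.sqrt (1 + ‖grad Ω f x‖ ^ 2)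
        * Real.cos (θ x)
      - Real.sqrt (1 + ‖grad Ω f x‖ ^ 2) * Real.sin (θ x) * tangentialDeriv Ω ρ θ x = 0 := by
  have hx0 := h.eq_zero_of_mem_frontier hx
  have hgx := h.gradient_ne_zero x hx0
  obtain ⟨N', hN', hNT⟩ := h.hasFDerivAt_innerNormal hgx
  have hq : HasFDerivWithinAt (grad Ω f) (hess Ω f x) (frontier Ω) x :=
    (hf2 x (frontier_subset_closure hx)).hasFDerivWithinAt.mono frontier_subset_closure
  have hθ' := (hθ.differentiableOn x hx).hasFDerivWithinAt
  have h1 := hN'.hasFDerivWithinAt (s := frontier Ω) |>.inner ℝ hq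
  have h2 := (hq.norm_sq.const_add 1).sqrt (by positivity)
  have h3 := h1.add (h2.mul hθ'.cos)
  have hzero : HasFDerivWithinAt (fun y => inner ℝ (innerNormal ρ y) (grad Ω f y) +
      Real.sqrt (1 + ‖grad Ω f y‖ ^ 2) * Real.cos (θ y)) (0 : E2 →L[ℝ] ℝ) (frontier Ω) x := by
    refine (hasFDerivWithinAt_const (0 : ℝ) x (frontier Ω)).congr (fun y hy => ?_) ?_
    · rw [hfc y hy]; ring
    · rw [hfc x hx]; ring
  have h4 := h3.unique_on hzero (h.mem_tangentConeAt_frontier hx0 (fderiv_unitTangent hgx))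
  have hv : Real.sqrt (1 + ‖grad Ω f x‖ ^ 2) ≠ 0 := (Real.sqrt_pos.2 (by positivity)).ne'
  simp only [add_apply, smul_apply, ContinuousLinearMap.comp_apply,
    ContinuousLinearMap.prod_apply, fderivInnerCLM_apply, zero_apply, smul_eq_mul, hNT,
    real_inner_smul_left, innerSL_apply_apply] at h4
  simp only [tangentialDeriv]
  rw [← h4]
  field_simp
  ring

lemma hess_symm (h : IsC3ConvexDomain Ω ρ) (hx : x ∈ closure Ω)
    (hf : DifferentiableOn ℝ f (closure Ω)) (hf2 : DifferentiableOn ℝ (grad Ω f) (closure Ω))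
    (v w : E2) : inner ℝ (hess Ω f x v) w = inner ℝ (hess Ω f x w) v := by
  have h1 : ∀ y ∈ interior (closure Ω),
      HasFDerivAt f (InnerProductSpace.toDual ℝ E2 (grad Ω f y)) y := fun y hy =>
    (hasFDerivWithinAt_of_grad (hf y (interior_subset hy))).hasFDerivAt
      (mem_interior_iff_mem_nhds.1 hy)
  set J : E2 →L[ℝ] StrongDual ℝ E2 :=
    (InnerProductSpace.toDual ℝ E2).toContinuousLinearEquiv.toContinuousLinearMap
  have h2 : HasFDerivWithinAt (fun y => InnerProductSpace.toDual ℝ E2 (grad Ω f y))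
      (J.comp (hess Ω f x)) (interior (closure Ω)) x :=
    J.hasFDerivAt.comp_hasFDerivWithinAt x
      ((hf2 x hx).hasFDerivWithinAt.mono interior_subset)
  exact h.convex.closure.second_derivative_within_at_symmetric h.interior_closure_nonempty
    h1 hx h2 v w

/-- First order conditions at a boundary maximum of `|Df|`. -/
lemma inner_hess_of_max_norm_grad (h : IsC3ConvexDomain Ω ρ) (hx : x ∈ frontier Ω)
    (hf2 : DifferentiableOn ℝ (grad Ω f) (closure Ω))
    (hmax : ∀ y ∈ closure Ω, ‖grad Ω f y‖ ≤ ‖grad Ω f x‖) :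
    inner ℝ (grad Ω f x) (hess Ω f x (unitTangent ρ x)) = 0 ∧
      inner ℝ (grad Ω f x) (hess Ω f x (innerNormal ρ x)) ≤ 0 := by
  have hxc := frontier_subset_closure hx
  have hN := norm_innerNormal (h.gradient_ne_zero x (h.eq_zero_of_mem_frontier hx))
  have key : ∀ ξ, 0 < inner ℝ (innerNormal ρ x) ξ →
      inner ℝ ((hess Ω f x).adjoint (grad Ω f x)) ξ ≤ 0 := by
    intro ξ hξ
    have hp := h.pointsInto_of_inner_pos hx hξ
    have h1 := (hp.hasDerivWithinAt (hf2 x hxc).hasFDerivWithinAt).norm_sq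
    have h2 := deriv_nonpos_of_eventually_le h1 (by
      filter_upwards [hp] with s hs
      have := hmax _ (subset_closure hs)
      simp only [zero_smul, add_zero]
      gcongr)
    rw [ContinuousLinearMap.adjoint_inner_left]
    simp only [zero_smul, add_zero] at h2
    exact (mul_nonpos_iff_pos_imp_nonpos.1 h2).1 (by norm_num)
  obtain ⟨h1, h2⟩ := eq_smul_of_inner_nonpos hN key
  rw [← ContinuousLinearMap.adjoint_inner_left, ← ContinuousLinearMap.adjoint_inner_left]
  refine ⟨?_, h2⟩
  rw [h1, real_inner_smul_left, real_inner_comm (unitTangent ρ x),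
    inner_unitTangent_innerNormal, mul_zero]

end Boundary

/-! ### The gradient bound at a boundary maximum -/

/-- The lower bound on `u_T u_{TN}`, with `p = u_T`, `b = u_{TN}`, `s = sin θ` and `θ' = D_T θ`. -/
lemma mixed_term_ge {p b k v s δ θ' : ℝ} (hb : b = k * p + v * s * θ')
    (hp : p ^ 2 = v ^ 2 * s ^ 2 - 1) (hθ' : |θ'| ≤ k - δ) (hδ : 0 ≤ δ) :
    δ * p ^ 2 - k / 2 ≤ p * b := by
  have h1 : |p * (v * s) * θ'| ≤ (p ^ 2 + 1 / 2) * (k - δ) := by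
    rw [abs_mul]
    refine mul_le_mul ?_ hθ' (abs_nonneg _) (by positivity)
    rw [abs_le]
    constructor
    · linarith [sq_nonneg (p + v * s)]
    · linarith [sq_nonneg (p - v * s)]
  have h2 := (abs_le.1 h1).1
  rw [hb]
  linarith

section BoundaryBound

variable {Ω : Set E2} {ρ θ : E2 → ℝ} {δ₀ θ₀ : ℝ} {f : E2 → ℝ} {x : E2}
  {F G : E3 → ℝ} {m₀ M₀ m₁ m₂ g₀ G₀ : ℝ}

/-- At a boundary maximum of `|Df|`, a bound on the elliptic operator makes
`v² = 1 + |Df|²` at most of order `v`. -/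
lemma boundary_gradient_estimate (h : IsC3ConvexDomain Ω ρ) (hθ : IsContactAngle Ω ρ θ δ₀ θ₀)
    (hδ₀ : 0 < δ₀) (hF : IsAnisotropy F m₀ M₀ m₁ m₂) (hG : IsMobility G g₀ G₀) (hg₀ : 0 < g₀)
    (hm : m₂ < m₀) (hx : x ∈ frontier Ω)
    (hf : DifferentiableOn ℝ f (closure Ω)) (hf2 : DifferentiableOn ℝ (grad Ω f) (closure Ω))
    (hfc : ContactCondition Ω ρ θ f)
    (hmax : ∀ y ∈ closure Ω, ‖grad Ω f y‖ ≤ ‖grad Ω f x‖) {C : ℝ}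
    (hC : |ellipticOp Ω F G f x| ≤ C) :
    g₀ * (m₀ - m₂) * (δ₀ * ((1 + ‖grad Ω f x‖ ^ 2) * Real.sin (θ x) ^ 2 - 1)
      - curvature ρ x / 2) ≤ C * Real.sqrt (1 + ‖grad Ω f x‖ ^ 2) := by
  have hxc := frontier_subset_closure hx
  have hgx := h.gradient_ne_zero x (h.eq_zero_of_mem_frontier hx)
  have hsymm := hess_symm h hxc hf hf2
  obtain ⟨hT1, hN1⟩ := inner_hess_of_max_norm_grad h hx hf2 hmax
  have htan := tangential_contact h hθ hx hf2 hfc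
  have hcon := hfc x hx
  have hTN := inner_unitTangent_innerNormal ρ x
  have hTn := norm_unitTangent hgx
  have hNn := norm_innerNormal hgx
  have hframe := eq_add_of_frame (ρ := ρ) hgx
  have hθ' := hθ.abs_deriv_le x hx
  rw [hT1, zero_div, zero_mul] at htan
  simp only [ellipticOp, hessEntry] at hC
  set k := curvature ρ x
  set T := unitTangent ρ x
  set N := innerNormal ρ x
  set q := grad Ω f x
  set H := hess Ω f x
  set v := Real.sqrt (1 + ‖q‖ ^ 2) with hv
  set c := g₀ * (m₀ - m₂) with hc
  have hc0 : 0 < c := mul_pos hg₀ (by linarith)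
  have hv0 : 0 < v := Real.sqrt_pos.2 (by positivity)
  have hvsq : v ^ 2 = 1 + ‖q‖ ^ 2 := Real.sq_sqrt (by positivity)
  have hC0 : 0 ≤ C := (abs_nonneg _).trans hC
  have hTT : inner ℝ T T = (1 : ℝ) := by rw [real_inner_self_eq_norm_sq, hTn]; norm_num
  have hNN : inner ℝ N N = (1 : ℝ) := by rw [real_inner_self_eq_norm_sq, hNn]; norm_num
  have hNT : inner ℝ N T = (0 : ℝ) := by rw [real_inner_comm]; exact hTN
  obtain ⟨p, hp⟩ : ∃ p : ℝ, p = inner ℝ q T := ⟨_, rfl⟩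
  obtain ⟨r, hr⟩ : ∃ r : ℝ, r = inner ℝ q N := ⟨_, rfl⟩
  obtain ⟨a, ha⟩ : ∃ a : ℝ, a = inner ℝ (H T) T := ⟨_, rfl⟩
  obtain ⟨b, hb⟩ : ∃ b : ℝ, b = inner ℝ (H T) N := ⟨_, rfl⟩
  obtain ⟨d, hd⟩ : ∃ d : ℝ, d = inner ℝ (H N) N := ⟨_, rfl⟩
  have hb' : inner ℝ (H N) T = b := by rw [hb, hsymm]
  have hq : q = p • T + r • N := by rw [hp, hr]; exact hframe q
  have hqn : ‖q‖ ^ 2 = p ^ 2 + r ^ 2 := by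
    rw [← real_inner_self_eq_norm_sq]
    nth_rewrite 2 [hq]
    rw [inner_add_right, real_inner_smul_right, real_inner_smul_right, ← hp, ← hr]
    ring
  have e1 : p * a + r * b = 0 := by
    rw [hq, inner_add_left, real_inner_smul_left, real_inner_smul_left, real_inner_comm,
      real_inner_comm (H T) N, ← ha, ← hb] at hT1
    exact hT1
  have e2 : p * b + r * d ≤ 0 := by
    rw [hq, inner_add_left, real_inner_smul_left, real_inner_smul_left, real_inner_comm,
      real_inner_comm (H N) N, hb', ← hd] at hN1
    exact hN1
  have hrv : r = -(v * Real.cos (θ x)) := by rw [hr, real_inner_comm]; exact hcon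
  have hpv : p ^ 2 = v ^ 2 * Real.sin (θ x) ^ 2 - 1 := by
    have h1 : r ^ 2 = v ^ 2 * Real.cos (θ x) ^ 2 := by rw [hrv]; ring
    have h2 := Real.sin_sq_add_cos_sq (θ x)
    have h3 : v ^ 2 * Real.sin (θ x) ^ 2 + v ^ 2 * Real.cos (θ x) ^ 2 = v ^ 2 := by
      rw [← mul_add, h2, mul_one]
    linarith
  have e3 : b = k * p + v * Real.sin (θ x) * tangentialDeriv Ω ρ θ x := by
    rw [real_inner_comm, ← hb, real_inner_comm, ← hp] at htan
    linarith
  have hA := mixed_term_ge e3 hpv hθ' hδ₀.le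
  have hk : 0 ≤ k := by linarith [abs_nonneg (tangentialDeriv Ω ρ θ x)]
  rw [← hvsq, ← hpv]
  -- It remains to bound `A = u_T u_{TN}` from above.
  suffices hgoal : c * (p * b) ≤ C * v ∨ p = 0 by
    rcases hgoal with h1 | h1
    · exact (mul_le_mul_of_nonneg_left hA hc0.le).trans h1
    · rw [h1]
      have h2 : c * (δ₀ * 0 ^ 2 - k / 2) ≤ 0 :=
        mul_nonpos_of_nonneg_of_nonpos hc0.le (by linarith)
      exact h2.trans (mul_nonneg hC0 hv0.le)
  rcases eq_or_ne p 0 with hp0 | hp0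
  · exact Or.inr hp0
  left
  rcases le_total (p * b) 0 with hA0 | hA0
  · exact (mul_nonpos_of_nonneg_of_nonpos hc0.le hA0).trans (mul_nonneg hC0 hv0.le)
  have hp2 : 0 < p ^ 2 := by positivity
  -- `w` is orthogonal to the gradient, and `u_T² u_N D²u + A w ⊗ w ≤ 0`.
  set w : E2 := r • T - p • N with hw
  have hqw : inner ℝ q w = 0 := by
    rw [hw, inner_sub_right, real_inner_smul_right, real_inner_smul_right, ← hp, ← hr]
    ring
  have hwn : p ^ 2 ≤ ‖w‖ ^ 2 := by
    have h1 : ‖w‖ ^ 2 = r ^ 2 + p ^ 2 := by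
      rw [← real_inner_self_eq_norm_sq, hw]
      simp only [inner_sub_left, inner_sub_right, real_inner_smul_left, real_inner_smul_right,
        hTT, hNN, hTN, hNT]
      ring
    rw [h1]
    linarith [sq_nonneg r]
  have hneg := sum_mul_nonpos (a := coeff F G q)
    (b := fun i j => p ^ 2 * r * H (EuclideanSpace.single j 1) i + p * b * (w i * w j))
    (coeff_comm hF _ 0 1) (sum_coeff_nonneg hF hG hg₀ _) (fun ξ => by
      have h1 : ∑ i : Fin 2, ∑ j : Fin 2, (p ^ 2 * r * H (EuclideanSpace.single j 1) i +
          p * b * (w i * w j)) * ξ i * ξ j =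
          p ^ 2 * r * inner ℝ (H ξ) ξ + p * b * inner ℝ w ξ ^ 2 := by
        rw [← sum_apply_single_mul_mul, PiLp.inner_apply]
        simp only [Fin.sum_univ_two, RCLike.inner_apply, conj_trivial]
        ring
      rw [h1]
      obtain ⟨α, hα⟩ : ∃ α : ℝ, α = inner ℝ ξ T := ⟨_, rfl⟩
      obtain ⟨β, hβ⟩ : ∃ β : ℝ, β = inner ℝ ξ N := ⟨_, rfl⟩
      have hξ : ξ = α • T + β • N := by rw [hα, hβ]; exact hframe ξ
      have h2 : inner ℝ (H ξ) ξ = α ^ 2 * a + 2 * α * β * b + β ^ 2 * d := by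
        rw [hξ]
        simp only [map_add, map_smul, inner_add_left, inner_add_right, real_inner_smul_left,
          real_inner_smul_right, ← ha, ← hb, ← hd, hb']
        ring
      have h3 : inner ℝ w ξ = r * α - p * β := by
        rw [hw, inner_sub_left, real_inner_smul_left, real_inner_smul_left, hα, hβ,
          real_inner_comm T, real_inner_comm N]
      rw [h2, h3]
      have h4 : p ^ 2 * r * (α ^ 2 * a + 2 * α * β * b + β ^ 2 * d) +
          p * b * (r * α - p * β) ^ 2 =
          α ^ 2 * p * r * (p * a + r * b) + β ^ 2 * p ^ 2 * (p * b + r * d) := by ring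
      rw [h4, e1, mul_zero, zero_add]
      exact mul_nonpos_of_nonneg_of_nonpos (by positivity) e2)
  have hell := le_sum_coeff_of_inner_eq_zero hF hG hg₀ hm hqw
  have hsplit : ∑ i : Fin 2, ∑ j : Fin 2, coeff F G q i j *
      (p ^ 2 * r * H (EuclideanSpace.single j 1) i + p * b * (w i * w j)) =
      p ^ 2 * (r * ∑ i : Fin 2, ∑ j : Fin 2, coeff F G q i j * H (EuclideanSpace.single j 1) i) +
      p * b * ∑ i : Fin 2, ∑ j : Fin 2, coeff F G q i j * w i * w j := by
    simp only [Fin.sum_univ_two]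
    ring
  rw [hsplit] at hneg
  set Λ := ∑ i : Fin 2, ∑ j : Fin 2, coeff F G q i j * H (EuclideanSpace.single j 1) i
  have h1 : p * b * (c * p ^ 2) ≤
      p * b * ∑ i : Fin 2, ∑ j : Fin 2, coeff F G q i j * w i * w j :=
    mul_le_mul_of_nonneg_left
      ((mul_le_mul_of_nonneg_left hwn hc0.le).trans hell) hA0
  have hrv' : |r| ≤ v := by
    rw [hrv, abs_neg, abs_mul, abs_of_pos hv0]
    exact mul_le_of_le_one_right hv0.le (Real.abs_cos_le_one _)
  have h2 : -(C * v) ≤ r * Λ := by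
    have h3 : |r * Λ| ≤ C * v := by
      rw [abs_mul, mul_comm]
      exact mul_le_mul hC hrv' (abs_nonneg _) hC0
    exact (abs_le.1 h3).1
  have h3 : p ^ 2 * (c * (p * b) - C * v) ≤ 0 := by
    have := mul_le_mul_of_nonneg_left h2 hp2.le
    linarith
  by_contra! hcontra
  have := mul_pos hp2 (sub_pos.2 hcontra)
  linarith

end BoundaryBound

/-! ### The uniform bound -/

section Initial

variable {Ω : Set E2} {ρ θ : E2 → ℝ} {u₀ : E2 → ℝ}

lemma IsInitialDatum.contDiffOn_grad (h : IsC3ConvexDomain Ω ρ) (hu₀ : IsInitialDatum Ω ρ θ u₀) :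
    ContDiffOn ℝ 2 (grad Ω u₀) (closure Ω) :=
  rieszMap.contDiff.comp_contDiffOn
    (hu₀.contDiffOn.fderivWithin (m := 2) h.uniqueDiffOn (by norm_num))

lemma IsInitialDatum.continuousOn_hess (h : IsC3ConvexDomain Ω ρ)
    (hu₀ : IsInitialDatum Ω ρ θ u₀) : ContinuousOn (hess Ω u₀) (closure Ω) :=
  (hu₀.contDiffOn_grad h).continuousOn_fderivWithin h.uniqueDiffOn (by norm_num)

end Initial

section Bound

variable {Ω : Set E2} {ρ θ : E2 → ℝ} {δ₀ θ₀ : ℝ} {f : E2 → ℝ} {x : E2}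
  {F G : E3 → ℝ} {m₀ M₀ m₁ m₂ g₀ G₀ : ℝ}

lemma norm_grad_le_of_max (h : IsC3ConvexDomain Ω ρ) (hθ : IsContactAngle Ω ρ θ δ₀ θ₀)
    (hδ₀ : 0 < δ₀) (hθ₀ : 0 < θ₀) (hF : IsAnisotropy F m₀ M₀ m₁ m₂) (hG : IsMobility G g₀ G₀)
    (hg₀ : 0 < g₀) (hm : m₂ < m₀) (hx : x ∈ frontier Ω)
    (hf : DifferentiableOn ℝ f (closure Ω)) (hf2 : DifferentiableOn ℝ (grad Ω f) (closure Ω))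
    (hfc : ContactCondition Ω ρ θ f)
    (hmax : ∀ y ∈ closure Ω, ‖grad Ω f y‖ ≤ ‖grad Ω f x‖) {C k₁ : ℝ} (hk₁ : 0 < k₁)
    (hk : curvature ρ x ≤ k₁) (hC : |ellipticOp Ω F G f x| ≤ C) :
    ‖grad Ω f x‖ ≤ (C + g₀ * (m₀ - m₂) * (δ₀ + k₁ / 2)) /
      (g₀ * (m₀ - m₂) * δ₀ * Real.sin θ₀ ^ 2) := by
  have hest := boundary_gradient_estimate h hθ hδ₀ hF hG hg₀ hm hx hf hf2 hfc hmax hC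
  have hlo := hθ.le_angle x hx
  have hhi := hθ.angle_le x hx
  have hs0 : 0 < Real.sin θ₀ := Real.sin_pos_of_pos_of_lt_pi hθ₀ (by linarith [Real.pi_pos])
  have hs : Real.sin θ₀ ≤ Real.sin (θ x) := by
    rcases le_total (θ x) (Real.pi / 2) with h1 | h1
    · exact Real.sin_le_sin_of_le_of_le_pi_div_two (by linarith [Real.pi_pos]) h1 hlo
    · rw [← Real.sin_pi_sub (θ x)]
      exact Real.sin_le_sin_of_le_of_le_pi_div_two (by linarith [Real.pi_pos]) (by linarith)
        (by linarith)
  set q := grad Ω f x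
  set v := Real.sqrt (1 + ‖q‖ ^ 2)
  set c := g₀ * (m₀ - m₂)
  have hc0 : 0 < c := mul_pos hg₀ (by linarith)
  have hvsq : v ^ 2 = 1 + ‖q‖ ^ 2 := Real.sq_sqrt (by positivity)
  have hv1 : 1 ≤ v := Real.one_le_sqrt.2 (by linarith [sq_nonneg ‖q‖])
  have hqv : ‖q‖ ≤ v := Real.le_sqrt_of_sq_le (by linarith)
  have hC0 : 0 ≤ C := (abs_nonneg _).trans hC
  rw [← hvsq] at hest
  have hsin : Real.sin θ₀ ^ 2 ≤ Real.sin (θ x) ^ 2 := by gcongr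
  have h1 : c * δ₀ * Real.sin θ₀ ^ 2 * v ^ 2 ≤ c * δ₀ * Real.sin (θ x) ^ 2 * v ^ 2 := by gcongr
  have h2 : c * curvature ρ x ≤ c * k₁ := by gcongr
  have h3 : c * (δ₀ + k₁ / 2) ≤ c * (δ₀ + k₁ / 2) * v := le_mul_of_one_le_right (by positivity) hv1
  have h4 : v * (c * δ₀ * Real.sin θ₀ ^ 2 * v) ≤ v * (C + c * (δ₀ + k₁ / 2)) := by linarith
  have h5 := le_of_mul_le_mul_left h4 (by linarith)
  refine hqv.trans ?_
  rw [le_div_iff₀ (by positivity)]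
  linarith

/-- `|Du|` attains its maximum over `closure Ω × [0, τ]` on the lateral boundary or at time `0`. -/
lemma IsSolution.exists_max_norm_grad {u₀ : E2 → ℝ} {τ : ℝ} {u : E2 → ℝ → ℝ}
    (h : IsC3ConvexDomain Ω ρ) (hF : IsAnisotropy F m₀ M₀ m₁ m₂) (hG : IsMobility G g₀ G₀)
    (hg₀ : 0 < g₀) (hτ : 0 < τ) (hu : IsSolution Ω ρ θ F G u₀ τ u) :
    ∃ x₁ ∈ closure Ω, ∃ t₁ ∈ Icc 0 τ, (x₁ ∈ frontier Ω ∨ t₁ = 0) ∧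
      ∀ x ∈ closure Ω, ∀ t ∈ Icc 0 τ,
        ‖grad Ω (fun y => u y t) x‖ ≤ ‖grad Ω (fun y => u y t₁) x₁‖ := by
  -- The parabolic boundary `Γ` is compact and nonempty.
  have h0 : (0 : ℝ) ∈ Icc 0 τ := ⟨le_rfl, hτ.le⟩
  obtain ⟨x, hx⟩ := h.nonempty
  set Γ : Set (E2 × ℝ) := frontier Ω ×ˢ Icc 0 τ ∪ closure Ω ×ˢ {0} with hΓ
  have hΓsub : Γ ⊆ closure Ω ×ˢ Icc 0 τ :=
    union_subset (prod_mono frontier_subset_closure le_rfl)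
      (prod_mono le_rfl (singleton_subset_iff.2 h0))
  have hΓc : IsCompact Γ :=
    ((h.isCompact_closure.of_isClosed_subset isClosed_frontier frontier_subset_closure).prod
      isCompact_Icc).union (h.isCompact_closure.prod isCompact_singleton)
  have hc : ContinuousOn (fun z : E2 × ℝ => ‖grad Ω (fun y => u y z.2) z.1‖) Γ :=
    hu.regular.continuousOn_grad.norm.mono hΓsub
  have hne : Γ.Nonempty := ⟨(x, 0), mem_union_right _ ⟨subset_closure hx, mem_singleton _⟩⟩
  obtain ⟨⟨x₁, t₁⟩, hz, hmax⟩ := hΓc.exists_isMaxOn hne hc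
  rw [isMaxOn_iff] at hmax
  have hlat : ∀ y ∈ frontier Ω, ∀ s ∈ Icc 0 τ,
      ‖grad Ω (fun y => u y s) y‖ ≤ ‖grad Ω (fun y => u y t₁) x₁‖ := fun y hy s hs =>
    hmax (y, s) (mem_union_left _ ⟨hy, hs⟩)
  have hinit : ∀ y ∈ closure Ω,
      ‖grad Ω (fun y => u y 0) y‖ ≤ ‖grad Ω (fun y => u y t₁) x₁‖ := fun y hy =>
    hmax (y, 0) (mem_union_right _ ⟨hy, mem_singleton _⟩)
  have hz' := hΓsub hz
  refine ⟨x₁, hz'.1, t₁, hz'.2, ?_, hu.norm_grad_le h hF hG hg₀ hlat hinit⟩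
  rcases hz with hz | hz
  · exact Or.inl hz.1
  · exact Or.inr hz.2

end Bound

end AnisoMCF

theorem theorem3p1
    (Ω : Set AnisoMCF.E2) (ρ : AnisoMCF.E2 → ℝ) (hΩ : AnisoMCF.IsC3ConvexDomain Ω ρ)
    (k₀ k₁ : ℝ) (hk₀ : 0 < k₀) (hk₁ : 0 < k₁)
    (hk : ∀ x ∈ frontier Ω, k₀ ≤ AnisoMCF.curvature ρ x ∧ AnisoMCF.curvature ρ x ≤ k₁)
    (θ : AnisoMCF.E2 → ℝ) (δ₀ θ₀ : ℝ) (hδ₀ : 0 < δ₀) (hθ₀ : 0 < θ₀)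
    (hθ : AnisoMCF.IsContactAngle Ω ρ θ δ₀ θ₀)
    (F : AnisoMCF.E3 → ℝ) (m₀ M₀ m₁ m₂ : ℝ)
    (hm₀ : 0 < m₀) (hM₀ : 0 < M₀) (hm₁ : 0 < m₁) (hm₂ : 0 < m₂)
    (hF : AnisoMCF.IsAnisotropy F m₀ M₀ m₁ m₂) (hm : m₂ < m₀)
    (G : AnisoMCF.E3 → ℝ) (g₀ G₀ : ℝ) (hg₀ : 0 < g₀) (hG₀ : 0 < G₀)
    (hG : AnisoMCF.IsMobility G g₀ G₀)
    (u₀ : AnisoMCF.E2 → ℝ) (hu₀ : AnisoMCF.IsInitialDatum Ω ρ θ u₀) :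
    ∃ C₁ : ℝ, 0 < C₁ ∧
      ∀ τ : ℝ, 0 < τ → ∀ u : AnisoMCF.E2 → ℝ → ℝ,
        AnisoMCF.IsSolution Ω ρ θ F G u₀ τ u →
          ∀ x ∈ Ω, ∀ t ∈ Set.Icc 0 τ, ‖AnisoMCF.grad Ω (fun y => u y t) x‖ ≤ C₁ := by
  have hcg := (hu₀.contDiffOn_grad hΩ).continuousOn
  obtain ⟨B, hB⟩ := hΩ.isCompact_closure.exists_bound_of_continuousOn hcg
  obtain ⟨C, hC⟩ := hΩ.isCompact_closure.exists_bound_of_continuousOn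
    (AnisoMCF.continuousOn_ellipticOp hF hG hcg (hu₀.continuousOn_hess hΩ))
  refine ⟨max 1 (max B ((C + g₀ * (m₀ - m₂) * (δ₀ + k₁ / 2)) /
    (g₀ * (m₀ - m₂) * δ₀ * Real.sin θ₀ ^ 2))), lt_max_of_lt_left one_pos,
    fun τ hτ u hu x hx t ht => ?_⟩
  have hE := hu.isContactEvolution
  have hinit := hu.initial_closure hτ hu₀.contDiffOn.continuousOn
  obtain ⟨x₁, hxc, t₁, ht₁, hcase, hall⟩ := hu.exists_max_norm_grad hΩ hF hG hg₀ hτ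
  refine (hall x (subset_closure hx) t ht).trans (le_max_of_le_right ?_)
  rcases hcase with hx₁ | rfl
  · refine le_max_of_le_right ?_
    refine AnisoMCF.norm_grad_le_of_max hΩ hθ hδ₀ hθ₀ hF hG hg₀ hm hx₁ (hE.diff t₁ ht₁)
      (hE.diff_grad t₁ ht₁) (hE.contact t₁ ht₁) (fun y hy => hall y hy t₁ ht₁) hk₁ (hk x₁ hx₁).2 ?_
    rw [← hu.equation_closure hF hG ht₁ x₁ hxc]
    exact hu.abs_timeDeriv_le hΩ hF hG hg₀ hτ hu₀.contDiffOn.continuousOn hC x₁ hxc t₁ ht₁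
  · refine le_max_of_le_left ?_
    rw [(AnisoMCF.ellipticOp_congr (F := F) (G := G) hinit hxc).1]
    exact hB x₁ hxc
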